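/- Fix $L>0$. For a function $\phi$ with $\phi(\alpha+1)=\phi(\alpha)-L$ and $\phi_\alpha<0$ put $$A=-\frac{\phi_{\alpha\alpha}}{\phi_\alpha^2}-3\frac{\phi_{\alpha\alpha}}{\phi_\alpha^4}+\frac{2\pi}{L^2}\,\mathrm{PV}\!\int_0^1\cot\frac{\pi(\phi(\alpha)-\phi(\beta))}{L}\,d\beta ,$$ and consider the $\phi$-PDE $\phi_t=-\partial_\alpha\big(\tfrac1{\phi_\alpha}\partial_\alpha A\big)$. Its linearization about a solution $\phi$ is $$\psi_t=-\partial_\alpha\Big(-\frac{\psi_\alpha}{\phi_\alpha^2}\,\partial_\alpha A+\frac{\partial_\alpha B}{\phi_\alpha}\Big),\qquad(\ast)$$ $$B=\Big(-\frac1{\phi_\alpha^2}-\frac3{\phi_\alpha^4}\Big)\psi_{\alpha\alpha}+\Big(\frac{2\phi_{\alpha\alpha}}{\phi_\alpha^3}+\frac{12\phi_{\alpha\alpha}}{\phi_\alpha^5}\Big)\psi_\alpha-\frac{2\pi^2}{L^3}\,\mathrm{PV}\!\int_0^1\csc^2\!\frac{\pi(\phi(\alpha)-\phi(\beta))}{L}\,(\psi(\alpha)-\psi(\beta))\,d\beta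 ,$$ for $1$-periodic (in $\alpha$) $\psi$. Principal values are taken over one period, removing a symmetric neighbourhood of $\beta=\alpha$. Let $m_1,m_2,T_m>0$. There is a constant $C=C(m_1,m_2,T_m)$, depending only on $m_1,m_2,T_m$, such that the following holds for every $L>0$. Let $\phi$ be a strong solution of the $\phi$-PDE on $[0,T_m]$ such that, for almost every $t$, $\phi(\cdot,t)\in W^{6,\infty}$ on one period, $\phi(\alpha+1,t)=\phi(\alpha,t)-L$, and $$\phi_\alpha\le -m_1<0,\qquad |\partial_\alpha^i\phi|\le m_2\quad(i=1,\dots,6)\ \text{ for a.e. }\alpha .$$ Let $\psi\in C([0,T_m];L^2_{\mathrm{per}}([0,1]))\cap L^2(0,T_m;H^2_{\mathrm{per}}([0,1]))$ be a weak solution of $(\ast)$, that is, for every smooth $1$-periodic $\eta$ and every $t\in[0,T_m]$, $$\int_0^1\psi(t)\,\eta\,d\alpha-\int_0^1\psi(0)\,\eta\,d\alpha=\int_0^t\!\int_0^1\Big[-\frac{\psi_\alpha}{\phi_\alpha^2}\,(\partial_\alpha A)\,\eta_\alpha-B\,\partial_\alpha\Big(\frac{\eta_\alpha}{\phi_\alpha}\Big)\Big]d\alpha\,ds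 ,$$ with integrable integrand. Then $$\|\psi(\cdot,t)\|_{L^2([0,1])}\le C(m_1,m_2,T_m)\,\|\psi(\cdot,0)\|_{L^2([0,1])}\qquad\text{for all }t\in[0,T_m].$$ -/

import Mathlib

open MeasureTheory Filter Topology Set

noncomputable section

namespace StepFlow

/-- Lebesgue measure on one period `[0,1]` of the step variable `α`. -/
def unitMeasure : Measure ℝ := volume.restrict (Icc (0 : ℝ) 1)

/-- Lebesgue measure on the space-time cylinder `[0,T] × [0,1]` (time first). -/
def cylinderMeasure (T : ℝ) : Measure (ℝ × ℝ) :=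
  volume.restrict (Icc (0 : ℝ) T ×ˢ Icc (0 : ℝ) 1)

/-- Cauchy principal value, over one period centred at the singularity `α`, of the integral of a
`1`-periodic function `f`: the limit as `δ → 0+` of the integral over `δ ≤ |β - α| ≤ 1/2`. -/
def pvPeriod (f : ℝ → ℝ) (α : ℝ) : ℝ :=
  limUnder (𝓝[>] (0 : ℝ)) fun δ : ℝ =>
    (∫ β in (α - 1 / 2)..(α - δ), f β) + ∫ β in (α + δ)..(α + 1 / 2), f β

/-- The chemical potential (first variation of the energy) as a function of the step location `φ`:
`A = -φ_αα/φ_α² - 3 φ_αα/φ_α⁴ + (2π/L²) PV∫₀¹ cot(π(φ(α)-φ(β))/L) dβ`. -/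
def potential (L : ℝ) (φ : ℝ → ℝ) (α : ℝ) : ℝ :=
  -(iteratedDeriv 2 φ α / deriv φ α ^ 2) - 3 * (iteratedDeriv 2 φ α / deriv φ α ^ 4)
    + 2 * Real.pi / L ^ 2 *
      pvPeriod (fun β => Real.cot (Real.pi * (φ α - φ β) / L)) α

/-- The right-hand side of the `φ`-equation: `-∂_α ((1/φ_α) ∂_α A)`. -/
def phiRHS (L : ℝ) (φ : ℝ → ℝ) (α : ℝ) : ℝ :=
  -deriv (fun y => 1 / deriv φ y * deriv (potential L φ) y) α

/-- The first variation of `potential` at `φ` in the direction `ψ`: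
`B = (-1/φ_α² - 3/φ_α⁴) ψ_αα + (2φ_αα/φ_α³ + 12φ_αα/φ_α⁵) ψ_α
     - (2π²/L³) PV∫₀¹ csc²(π(φ(α)-φ(β))/L) (ψ(α)-ψ(β)) dβ`. -/
def potentialVariation (L : ℝ) (φ ψ : ℝ → ℝ) (α : ℝ) : ℝ :=
  (-(1 / deriv φ α ^ 2) - 3 * (1 / deriv φ α ^ 4)) * iteratedDeriv 2 ψ α
    + (2 * iteratedDeriv 2 φ α / deriv φ α ^ 3 + 12 * iteratedDeriv 2 φ α / deriv φ α ^ 5)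
        * deriv ψ α
    - 2 * Real.pi ^ 2 / L ^ 3 *
      pvPeriod (fun β => 1 / Real.sin (Real.pi * (φ α - φ β) / L) ^ 2 * (ψ α - ψ β)) α

/-- The space `W^{6,∞}_{per⋆}(0,1)` of step location functions: `f(α+1) - f(α) = -L`, and `f` is
(represented by) a `C⁵` function whose fifth derivative is Lipschitz. -/
def MemW6Star (L : ℝ) (f : ℝ → ℝ) : Prop :=
  (∀ α, f (α + 1) - f α = -L) ∧ ContDiff ℝ 5 f ∧ ∃ K, LipschitzWith K (iteratedDeriv 5 f)

/-- `φ` (time first) is a strong solution on `[0,T]` of `φ_t = -∂_α ((1/φ_α) ∂_α A)` with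
`φ(·,t) ∈ W^{6,∞}_{per⋆}(0,1)` for a.e. `t`: at every `α` it is absolutely continuous in time and
is the time integral of the right-hand side. -/
structure IsStrongSolution (L T : ℝ) (φ : ℝ → ℝ → ℝ) : Prop where
  regular : ∀ᵐ t ∂(volume.restrict (Icc (0 : ℝ) T)), MemW6Star L (φ t)
  integrable : ∀ α, IntervalIntegrable (fun s => phiRHS L (φ s) α) volume 0 T
  equation : ∀ t ∈ Icc (0 : ℝ) T, ∀ α, φ t α = φ 0 α + ∫ s in (0 : ℝ)..t, phiRHS L (φ s) α

/-- The bounds `φ_α ≤ -m₁` and `|∂_α^i φ| ≤ m₂`, `i = 1, …, 6`, a.e. on `[0,T]`. -/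
def HasBounds (m₁ m₂ T : ℝ) (φ : ℝ → ℝ → ℝ) : Prop :=
  ∀ᵐ t ∂(volume.restrict (Icc (0 : ℝ) T)),
    (∀ α, deriv (φ t) α ≤ -m₁) ∧
      ∀ i ∈ Finset.Icc 1 6, ∀ᵐ α, |iteratedDeriv i (φ t) α| ≤ m₂

/-- The periodic Sobolev space `H²_per(0,1)`: `1`-periodic `C¹` functions with absolutely
continuous derivative and square integrable second derivative. -/
def MemH2Per (f : ℝ → ℝ) : Prop :=
  Function.Periodic f 1 ∧ ContDiff ℝ 1 f ∧
    (∀ a b, AbsolutelyContinuousOnInterval (deriv f) a b) ∧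
    MemLp (iteratedDeriv 2 f) 2 unitMeasure

/-- The integrand of the weak form of
`ψ_t = -∂_α (-(ψ_α/φ_α²) ∂_α A + (∂_α B)/φ_α)` tested with `η`, after moving the outer derivative
and the derivative of `B` to the test function. -/
def weakIntegrand (L : ℝ) (φ ψ η : ℝ → ℝ) (α : ℝ) : ℝ :=
  -(deriv ψ α / deriv φ α ^ 2) * deriv (potential L φ) α * deriv η α
    - potentialVariation L φ ψ α * deriv (fun y => deriv η y / deriv φ y) α

/-- `ψ` (time first) is a weak solution on `[0,T]`, in the energy class
`C([0,T]; L²_per) ∩ L²(0,T; H²_per)`, of the linearization of the `φ`-equation at `φ`. -/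
structure IsLinearizedSolution (L T : ℝ) (φ ψ : ℝ → ℝ → ℝ) : Prop where
  periodic : ∀ t ∈ Icc (0 : ℝ) T, Function.Periodic (ψ t) 1
  memL2 : ∀ t ∈ Icc (0 : ℝ) T, MemLp (ψ t) 2 unitMeasure
  continuousL2 : ∀ t₀ ∈ Icc (0 : ℝ) T,
    Tendsto (fun t => eLpNorm (fun α => ψ t α - ψ t₀ α) 2 unitMeasure)
      (𝓝[Icc (0 : ℝ) T] t₀) (𝓝 0)
  memH2 : ∀ᵐ t ∂(volume.restrict (Icc (0 : ℝ) T)), MemH2Per (ψ t)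
  memL2H2 : ∀ i ≤ 2,
    MemLp (fun p : ℝ × ℝ => iteratedDeriv i (ψ p.1) p.2) 2 (cylinderMeasure T)
  integrable : ∀ η : ℝ → ℝ, ContDiff ℝ (⊤ : ℕ∞) η → Function.Periodic η 1 →
    Integrable (fun p : ℝ × ℝ => weakIntegrand L (φ p.1) (ψ p.1) η p.2) (cylinderMeasure T)
  equation : ∀ η : ℝ → ℝ, ContDiff ℝ (⊤ : ℕ∞) η → Function.Periodic η 1 →
    ∀ t ∈ Icc (0 : ℝ) T,
      (∫ α in (0 : ℝ)..1, ψ t α * η α) - (∫ α in (0 : ℝ)..1, ψ 0 α * η α) =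
        ∫ s in (0 : ℝ)..t, ∫ α in (0 : ℝ)..1, weakIntegrand L (φ s) (ψ s) η α

end StepFlow

end

namespace StepFlow

/-! ### Elementary estimates for the trigonometric kernels -/

/-! The proof is an energy estimate. Write `N = ∫ ψ²` and `E = ∫ ψ_αα²` over a period. Sorting the
weak form by derivatives of the test function gives `∫ fluxOne · η_α + fluxTwo · η_αα`, so formally
`N' = 2 ∫ (fluxOne · ψ_α + fluxTwo · ψ_αα)`. The leading part of `fluxTwo` is `(1/φ_α² + 3/φ_α⁴)
ψ_αα / φ_α`. Since `-m₂ ≤ φ_α < 0`, it dissipates at least a fixed multiple of `E`. Everything else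
must be absorbed, leaving `N' ≤ 2 K N`, and Grönwall concludes.

The obstacle is the hypersingular integral with kernel `csc²`. Pairing the points `α ± h` turns its
numerator into a second difference of `ψ`, up to a milder error due to the curvature of `φ`. That
difference is at most `2 M h`, with `M = sup |ψ_α|`, and at most `√(2hE) h`, by the Hölder-1/2 bound
on `ψ_α`. The second bound alone would make the term as large as `√E`, with no small factor
available. The geometric mean of the two still leaves the integrable weight `h^(-3/4)`, and bounds
the term by a multiple of `X = √(M √E)`. The interpolation `M⁸ ≤ 16 N E³` gives `X¹⁶ ≤ 16 N E⁷`,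
hence an exponent of `E` below one in `X²`, and the dissipation absorbs `X²` (`interpolation_le`,
`exists_energy_bound`). The coefficient `∂_α A` is bounded by the same pairing, applied to the
cotangent kernel (`exists_abs_deriv_potential_le`). Constants do not depend on `L`, because the
slope bounds force `m₁ ≤ L ≤ m₂`.

Since `ψ` is not an admissible test function, `energy_identity` tests with sines and cosines only.
Each Fourier coefficient of `ψ` is a primitive in time, so its square obeys the chain rule. The
modes are summed by Parseval, with dominated convergence in time under a multiple of `E(s)`, which
is integrable because `ψ ∈ L² H²`. -/

theorem two_div_pi_mul_le_sin {m θ : ℝ} (hm : 0 ≤ m) (h₁ : m ≤ θ) (h₂ : m ≤ Real.pi - θ) :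
    2 / Real.pi * m ≤ Real.sin θ := by
  have hpi := Real.pi_pos
  have hc : 0 ≤ 2 / Real.pi := by positivity
  rcases le_total θ (Real.pi / 2) with h | h
  · exact (mul_le_mul_of_nonneg_left h₁ hc).trans (Real.mul_le_sin (hm.trans h₁) h)
  · rw [← Real.sin_pi_sub]
    exact (mul_le_mul_of_nonneg_left h₂ hc).trans (Real.mul_le_sin (hm.trans h₂) (by linarith))

section Kernel

variable {x y h c k : ℝ}

theorem inv_sin_sq_le (hh : 0 < h) (hc : 0 < c) (hx : c * h ≤ |Real.sin x|) :
    1 / Real.sin x ^ 2 ≤ 1 / (c ^ 2 * h ^ 2) := by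
  have : c ^ 2 * h ^ 2 ≤ Real.sin x ^ 2 := by
    rw [← mul_pow, ← sq_abs (Real.sin x)]
    exact pow_le_pow_left₀ (by positivity) hx 2
  exact one_div_le_one_div_of_le (by positivity) this

theorem abs_cot_add_cot_le (hh : 0 < h) (hc : 0 < c) (hx : c * h ≤ |Real.sin x|)
    (hy : c * h ≤ |Real.sin y|) (hxy : |x + y| ≤ k * h ^ 2) :
    |Real.cot x + Real.cot y| ≤ k / c ^ 2 := by
  have hch : 0 < c * h := by positivity
  have hx0 : Real.sin x ≠ 0 := abs_pos.1 (hch.trans_le hx)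
  have hy0 : Real.sin y ≠ 0 := abs_pos.1 (hch.trans_le hy)
  have e : Real.cot x + Real.cot y = Real.sin (x + y) / (Real.sin x * Real.sin y) := by
    rw [Real.cot_eq_cos_div_sin, Real.cot_eq_cos_div_sin, Real.sin_add]
    field_simp
    ring
  have hs : |Real.sin (x + y)| ≤ k * h ^ 2 := Real.abs_sin_le_abs.trans hxy
  rw [e, abs_div, abs_mul]
  calc _ ≤ k * h ^ 2 / ((c * h) * (c * h)) := by
        apply div_le_div₀ ((abs_nonneg _).trans hs) hs (by positivity)
        exact mul_le_mul hx hy hch.le (abs_nonneg _)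
    _ = k / c ^ 2 := by field_simp

theorem abs_inv_sin_sq_sub_le (hh : 0 < h) (hc : 0 < c) (hx : c * h ≤ |Real.sin x|)
    (hy : c * h ≤ |Real.sin y|) (hxy : |x + y| ≤ k * h ^ 2) (hxy' : |x - y| ≤ k * h) :
    |1 / Real.sin y ^ 2 - 1 / Real.sin x ^ 2| ≤ k ^ 2 / (c ^ 4 * h) := by
  have hch : 0 < c * h := by positivity
  have hx0 : Real.sin x ≠ 0 := abs_pos.1 (hch.trans_le hx)
  have hy0 : Real.sin y ≠ 0 := abs_pos.1 (hch.trans_le hy)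
  have e : 1 / Real.sin y ^ 2 - 1 / Real.sin x ^ 2
      = Real.sin (x + y) * Real.sin (x - y) / (Real.sin x ^ 2 * Real.sin y ^ 2) := by
    have : Real.sin (x + y) * Real.sin (x - y) = Real.sin x ^ 2 - Real.sin y ^ 2 := by
      rw [Real.sin_add, Real.sin_sub]
      linear_combination Real.sin x ^ 2 * Real.sin_sq_add_cos_sq y
        - Real.sin y ^ 2 * Real.sin_sq_add_cos_sq x
    rw [this]
    field_simp
  have hs : |Real.sin (x + y)| ≤ k * h ^ 2 := Real.abs_sin_le_abs.trans hxy
  have hs' : |Real.sin (x - y)| ≤ k * h := Real.abs_sin_le_abs.trans hxy'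
  have hx2 : (c * h) ^ 2 ≤ Real.sin x ^ 2 := by
    rw [← sq_abs (Real.sin x)]; exact pow_le_pow_left₀ hch.le hx 2
  have hy2 : (c * h) ^ 2 ≤ Real.sin y ^ 2 := by
    rw [← sq_abs (Real.sin y)]; exact pow_le_pow_left₀ hch.le hy 2
  rw [e, abs_div, abs_mul, abs_of_nonneg (by positivity : 0 ≤ Real.sin x ^ 2 * Real.sin y ^ 2)]
  calc _ ≤ (k * h ^ 2) * (k * h) / ((c * h) ^ 2 * (c * h) ^ 2) := by
        apply div_le_div₀
        · exact mul_nonneg ((abs_nonneg _).trans hs) ((abs_nonneg _).trans hs')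
        · exact mul_le_mul hs hs' (abs_nonneg _) ((abs_nonneg _).trans hs)
        · positivity
        · exact mul_le_mul hx2 hy2 (by positivity) (by positivity)
    _ = k ^ 2 / (c ^ 4 * h) := by field_simp

/-- The angles `x`, `y` belong to the points `α ± h` and are opposite up to `O(h²)`. As `csc²` is
even, `csc² x` and `csc² y` differ only by `O(1/h)`, so the full `1/h²` singularity meets only the
sum `p + q`, where cancellation is available. -/
theorem abs_inv_sin_sq_mul_add_le (hh : 0 < h) (hc : 0 < c) (hx : c * h ≤ |Real.sin x|)
    (hy : c * h ≤ |Real.sin y|) (hxy : |x + y| ≤ k * h ^ 2) (hxy' : |x - y| ≤ k * h) (p q : ℝ) :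
    |1 / Real.sin x ^ 2 * p + 1 / Real.sin y ^ 2 * q|
      ≤ |p + q| / (c ^ 2 * h ^ 2) + k ^ 2 * |q| / (c ^ 4 * h) := by
  have e : 1 / Real.sin x ^ 2 * p + 1 / Real.sin y ^ 2 * q
      = 1 / Real.sin x ^ 2 * (p + q) + (1 / Real.sin y ^ 2 - 1 / Real.sin x ^ 2) * q := by ring
  rw [e]
  refine (abs_add_le _ _).trans (add_le_add ?_ ?_)
  · rw [abs_mul, abs_of_nonneg (by positivity : 0 ≤ 1 / Real.sin x ^ 2)]
    refine (mul_le_mul_of_nonneg_right (inv_sin_sq_le hh hc hx) (abs_nonneg _)).trans_eq ?_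
    ring
  · rw [abs_mul]
    refine (mul_le_mul_of_nonneg_right (abs_inv_sin_sq_sub_le hh hc hx hy hxy hxy')
      (abs_nonneg _)).trans_eq ?_
    ring

end Kernel

theorem abs_second_difference_le {f : ℝ → ℝ} (hf : Differentiable ℝ f) {α h κ : ℝ} (hh : 0 ≤ h)
    (hκ : ∀ u ∈ Icc 0 h, |deriv f (α + u) - deriv f (α - u)| ≤ κ) :
    |(f α - f (α + h)) + (f α - f (α - h))| ≤ κ * h := by
  have hd : ∀ u : ℝ, HasDerivAt (fun u => f (α + u) + f (α - u))
      (deriv f (α + u) - deriv f (α - u)) u := by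
    intro u
    have h1 := (hf (α + u)).hasDerivAt.comp_const_add α u
    have h2 := (hf (α - u)).hasDerivAt.comp_const_sub α u
    exact (h1.add h2).congr_deriv (sub_eq_add_neg _ _).symm
  have := norm_image_sub_le_of_norm_deriv_le_segment' (a := 0) (b := h) (C := κ)
    (fun u _ => (hd u).hasDerivWithinAt) (fun u hu => hκ u (Ico_subset_Icc_self hu)) h ⟨hh, le_rfl⟩
  rw [Real.norm_eq_abs, abs_sub_comm] at this
  simp only [add_zero, sub_zero] at this
  convert this using 2
  ring

/-! ### The principal value as a symmetrized integral -/

/-- Folding the two halves onto one variable `h` makes the truncated integrals values of the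
primitive of an integrable function, and that primitive is continuous at `δ = 0`. This shows that
the limit in `limUnder` exists, so that it is not a default value. -/
theorem pvPeriod_eq_integral {f : ℝ → ℝ} {α : ℝ}
    (h₁ : ContinuousOn (fun h => f (α + h)) (Ioc 0 (1 / 2)))
    (h₂ : ContinuousOn (fun h => f (α - h)) (Ioc 0 (1 / 2)))
    (hint : IntervalIntegrable (fun h => f (α + h) + f (α - h)) volume 0 (1 / 2)) :
    pvPeriod f α = ∫ h in (0 : ℝ)..(1 / 2), (f (α + h) + f (α - h)) := by
  refine Tendsto.limUnder_eq ?_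
  have hcont : ContinuousOn (fun δ => ∫ h in δ..(1 / 2 : ℝ), (f (α + h) + f (α - h)))
      (uIcc 0 (1 / 2)) :=
    intervalIntegral.continuousOn_primitive_interval_left (by
      rw [uIcc_of_le (by norm_num)]
      rwa [intervalIntegrable_iff_integrableOn_Icc_of_le (by norm_num)] at hint)
  have h0 := (hcont 0 (by simp)).tendsto
  rw [uIcc_of_le (by norm_num)] at h0
  have h0' := h0.mono_left (nhdsWithin_mono (0 : ℝ) (Ioc_subset_Icc_self (a := (0 : ℝ)) (b := 1 / 2)))
  rw [nhdsWithin_Ioc_eq_nhdsGT (by norm_num)] at h0'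
  refine h0'.congr' ?_
  filter_upwards [Ioc_mem_nhdsGT (by norm_num : (0 : ℝ) < 1 / 2)] with δ hδ
  have hsub : uIcc δ (1 / 2) ⊆ Ioc 0 (1 / 2) := by
    rw [uIcc_of_le hδ.2]
    exact fun x hx => ⟨hδ.1.trans_le hx.1, hx.2⟩
  rw [intervalIntegral.integral_add (h₁.mono hsub).intervalIntegrable
    (h₂.mono hsub).intervalIntegrable, add_comm]
  congr 1
  · rw [intervalIntegral.integral_comp_sub_left (fun x => f x) α]
  · rw [intervalIntegral.integral_comp_add_left (fun x => f x) α]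

/-! ### Step profiles -/

/-- A decreasing step location function with slope bounded away from zero and bounded derivatives
up to order three. -/
structure IsProfile (m₁ m₂ L : ℝ) (φ : ℝ → ℝ) : Prop where
  contDiff : ContDiff ℝ 3 φ
  shift : ∀ α, φ (α + 1) = φ α - L
  deriv_le : ∀ α, deriv φ α ≤ -m₁
  le_deriv : ∀ α, -m₂ ≤ deriv φ α
  abs_second : ∀ α, |deriv (deriv φ) α| ≤ m₂
  abs_third : ∀ α, |deriv (deriv (deriv φ)) α| ≤ m₂

namespace IsProfile

variable {m₁ m₂ L : ℝ} {φ : ℝ → ℝ}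

theorem differentiable (hφ : IsProfile m₁ m₂ L φ) : Differentiable ℝ φ :=
  hφ.contDiff.differentiable (by norm_num)

theorem contDiff_deriv (hφ : IsProfile m₁ m₂ L φ) : ContDiff ℝ 2 (deriv φ) :=
  (contDiff_succ_iff_deriv (n := 2)).1 (two_add_one_eq_three (R := WithTop ℕ∞) ▸ hφ.contDiff) |>.2.2

theorem contDiff_deriv_deriv (hφ : IsProfile m₁ m₂ L φ) : ContDiff ℝ 1 (deriv (deriv φ)) :=
  (contDiff_succ_iff_deriv (n := 1)).1 (one_add_one_eq_two (R := WithTop ℕ∞) ▸ hφ.contDiff_deriv) |>.2.2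

theorem differentiable_deriv (hφ : IsProfile m₁ m₂ L φ) : Differentiable ℝ (deriv φ) :=
  hφ.contDiff_deriv.differentiable (by norm_num)

theorem differentiable_deriv_deriv (hφ : IsProfile m₁ m₂ L φ) :
    Differentiable ℝ (deriv (deriv φ)) :=
  hφ.contDiff_deriv_deriv.differentiable (by norm_num)

theorem continuous (hφ : IsProfile m₁ m₂ L φ) : Continuous φ := hφ.contDiff.continuous

theorem lower (hφ : IsProfile m₁ m₂ L φ) {a b : ℝ} (hab : a ≤ b) :
    m₁ * (b - a) ≤ φ a - φ b := by
  have := image_sub_le_mul_sub_of_deriv_le hφ.differentiable hφ.deriv_le hab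
  linarith

theorem upper (hφ : IsProfile m₁ m₂ L φ) {a b : ℝ} (hab : a ≤ b) :
    φ a - φ b ≤ m₂ * (b - a) := by
  have := mul_sub_le_image_sub_of_le_deriv hφ.differentiable hφ.le_deriv hab
  linarith

theorem le_period (hφ : IsProfile m₁ m₂ L φ) : m₁ ≤ L := by
  have := hφ.lower (zero_le_one' ℝ)
  have h2 := hφ.shift 0
  rw [zero_add] at h2
  linarith

theorem period_le (hφ : IsProfile m₁ m₂ L φ) : L ≤ m₂ := by
  have := hφ.upper (zero_le_one' ℝ)
  have h2 := hφ.shift 0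
  rw [zero_add] at h2
  linarith

theorem abs_deriv_sub_le (hφ : IsProfile m₁ m₂ L φ) (a b : ℝ) :
    |deriv φ a - deriv φ b| ≤ m₂ * |a - b| := by
  have := Convex.norm_image_sub_le_of_norm_deriv_le (s := univ) (C := m₂)
    (fun x _ => hφ.differentiable_deriv x) (fun x _ => hφ.abs_second x) convex_univ
    (mem_univ b) (mem_univ a)
  simpa using this

theorem abs_deriv_deriv_sub_le (hφ : IsProfile m₁ m₂ L φ) (a b : ℝ) :
    |deriv (deriv φ) a - deriv (deriv φ) b| ≤ m₂ * |a - b| := by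
  have := Convex.norm_image_sub_le_of_norm_deriv_le (s := univ) (C := m₂)
    (fun x _ => hφ.differentiable_deriv_deriv x) (fun x _ => hφ.abs_third x) convex_univ
    (mem_univ b) (mem_univ a)
  simpa using this

/-- The monotonicity of `φ` keeps the angle at distance at least `π m₁ h / L` from both `0` and `π`;
the latter uses `h ≤ 1/2`, as the rest of the period has length `1 - h ≥ h`. Concavity of the sine
then gives a linear bound, and `L ≤ m₂` removes `L`. -/
theorem sin_lower (hm₁ : 0 < m₁) (hφ : IsProfile m₁ m₂ L φ) {α h : ℝ} (hh : 0 ≤ h)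
    (hh' : h ≤ 1 / 2) :
    2 * m₁ / m₂ * h ≤ Real.sin (Real.pi * (φ α - φ (α + h)) / L) := by
  have hL : 0 < L := hm₁.trans_le hφ.le_period
  have hpi := Real.pi_pos
  have h1 := hφ.lower (show α ≤ α + h by linarith)
  have h2 := hφ.lower (show α + h ≤ α + 1 by linarith)
  rw [hφ.shift] at h2
  have key := two_div_pi_mul_le_sin (m := Real.pi * (m₁ * h) / L)
    (θ := Real.pi * (φ α - φ (α + h)) / L) (by positivity) (by gcongr; linarith) (by
      have : Real.pi - Real.pi * (φ α - φ (α + h)) / L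
          = Real.pi * (L - (φ α - φ (α + h))) / L := by field_simp
      rw [this]
      gcongr
      nlinarith)
  refine le_trans ?_ key
  have : 2 / Real.pi * (Real.pi * (m₁ * h) / L) = 2 * m₁ / L * h := by field_simp
  rw [this]
  gcongr
  exact hφ.period_le

theorem abs_sin_lower (hm₁ : 0 < m₁) (hφ : IsProfile m₁ m₂ L φ) {α h : ℝ} (hh : 0 ≤ h)
    (hh' : h ≤ 1 / 2) :
    2 * m₁ / m₂ * h ≤ |Real.sin (Real.pi * (φ α - φ (α + h)) / L)| :=
  (hφ.sin_lower hm₁ hh hh').trans (le_abs_self _)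

theorem abs_sin_lower' (hm₁ : 0 < m₁) (hφ : IsProfile m₁ m₂ L φ) {α h : ℝ} (hh : 0 ≤ h)
    (hh' : h ≤ 1 / 2) :
    2 * m₁ / m₂ * h ≤ |Real.sin (Real.pi * (φ α - φ (α - h)) / L)| := by
  have := hφ.abs_sin_lower hm₁ (α := α - h) hh hh'
  rw [sub_add_cancel] at this
  rwa [show Real.pi * (φ α - φ (α - h)) / L = -(Real.pi * (φ (α - h) - φ α) / L) by ring,
    Real.sin_neg, abs_neg]

theorem abs_pi_mul_div_le (hm₁ : 0 < m₁) (hφ : IsProfile m₁ m₂ L φ) {x b : ℝ}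
    (hx : |x| ≤ 2 * m₂ * b) : |Real.pi * x / L| ≤ 2 * Real.pi * m₂ / m₁ * b := by
  have hL : 0 < L := hm₁.trans_le hφ.le_period
  have hpi := Real.pi_pos
  have h0 : 0 ≤ 2 * m₂ * b := (abs_nonneg _).trans hx
  rw [abs_div, abs_mul, abs_of_pos hL, abs_of_pos hpi]
  calc Real.pi * |x| / L ≤ Real.pi * (2 * m₂ * b) / m₁ := by
        apply div_le_div₀ (by positivity) (by gcongr) hm₁ hφ.le_period
    _ = _ := by ring

theorem abs_angle_add_le (hm₁ : 0 < m₁) (hφ : IsProfile m₁ m₂ L φ) {α h : ℝ} (hh : 0 ≤ h) :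
    |Real.pi * (φ α - φ (α + h)) / L + Real.pi * (φ α - φ (α - h)) / L|
      ≤ 2 * Real.pi * m₂ / m₁ * h ^ 2 := by
  have hm₂ : 0 ≤ m₂ := hm₁.le.trans (hφ.le_period.trans hφ.period_le)
  rw [← add_div, ← mul_add]
  refine hφ.abs_pi_mul_div_le hm₁ ?_
  refine (abs_second_difference_le hφ.differentiable hh (κ := m₂ * (2 * h)) ?_).trans_eq (by ring)
  intro u hu
  refine (hφ.abs_deriv_sub_le _ _).trans ?_
  have : α + u - (α - u) = 2 * u := by ring
  rw [this, abs_of_nonneg (by linarith [hu.1])]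
  gcongr
  exact hu.2

theorem abs_angle_deriv_add_le (hm₁ : 0 < m₁) (hφ : IsProfile m₁ m₂ L φ) {α h : ℝ}
    (hh : 0 ≤ h) :
    |Real.pi * (deriv φ α - deriv φ (α + h)) / L + Real.pi * (deriv φ α - deriv φ (α - h)) / L|
      ≤ 2 * Real.pi * m₂ / m₁ * h ^ 2 := by
  have hm₂ : 0 ≤ m₂ := hm₁.le.trans (hφ.le_period.trans hφ.period_le)
  rw [← add_div, ← mul_add]
  refine hφ.abs_pi_mul_div_le hm₁ ?_
  refine (abs_second_difference_le hφ.differentiable_deriv hh (κ := m₂ * (2 * h)) ?_).trans_eq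
    (by ring)
  intro u hu
  refine (hφ.abs_deriv_deriv_sub_le _ _).trans ?_
  have : α + u - (α - u) = 2 * u := by ring
  rw [this, abs_of_nonneg (by linarith [hu.1])]
  gcongr
  exact hu.2

theorem abs_angle_sub_le (hm₁ : 0 < m₁) (hφ : IsProfile m₁ m₂ L φ) {α h : ℝ} (hh : 0 ≤ h) :
    |Real.pi * (φ α - φ (α + h)) / L - Real.pi * (φ α - φ (α - h)) / L|
      ≤ 2 * Real.pi * m₂ / m₁ * h := by
  rw [← sub_div, ← mul_sub]
  refine hφ.abs_pi_mul_div_le hm₁ ?_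
  have h1 := hφ.lower (show α - h ≤ α + h by linarith)
  have h2 := hφ.upper (show α - h ≤ α + h by linarith)
  have h3 : 0 ≤ m₁ * (α + h - (α - h)) := mul_nonneg hm₁.le (by linarith)
  rw [abs_le]
  constructor <;> nlinarith

theorem abs_angle_deriv_le (hm₁ : 0 < m₁) (hφ : IsProfile m₁ m₂ L φ) {α h : ℝ} (hh : 0 ≤ h) :
    |Real.pi * (deriv φ α - deriv φ (α - h)) / L| ≤ 2 * Real.pi * m₂ / m₁ * h := by
  have hm₂ : 0 ≤ m₂ := hm₁.le.trans (hφ.le_period.trans hφ.period_le)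
  refine hφ.abs_pi_mul_div_le hm₁ ?_
  refine (hφ.abs_deriv_sub_le _ _).trans ?_
  have : α - (α - h) = h := by ring
  rw [this, abs_of_nonneg hh]
  nlinarith [mul_nonneg hm₂ hh]

end IsProfile

/-! ### Lipschitz bounds for the cotangent potential -/

theorem intervalIntegrable_of_continuousOn_Ioc {g b : ℝ → ℝ} {r : ℝ} (hr : 0 ≤ r)
    (hg : ContinuousOn g (Ioc 0 r)) (hb : IntervalIntegrable b volume 0 r)
    (hgb : ∀ h ∈ Ioc 0 r, |g h| ≤ b h) : IntervalIntegrable g volume 0 r := by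
  refine hb.mono_fun' ?_ ?_
  · rw [uIoc_of_le hr]
    exact hg.aestronglyMeasurable measurableSet_Ioc
  · rw [uIoc_of_le hr]
    exact (ae_restrict_iff' measurableSet_Ioc).2 (ae_of_all _ hgb)

theorem hasDerivAt_cot_comp {u : ℝ → ℝ} {u' x : ℝ} (hu : HasDerivAt u u' x)
    (hs : Real.sin (u x) ≠ 0) :
    HasDerivAt (fun y => Real.cot (u y)) (-(1 / Real.sin (u x) ^ 2 * u')) x := by
  have h := hu.cos.div hu.sin hs
  have e : (fun y => Real.cot (u y)) = fun y => Real.cos (u y) / Real.sin (u y) := by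
    funext y; rw [Real.cot_eq_cos_div_sin]
  rw [e]
  refine h.congr_deriv ?_
  field_simp
  linear_combination (-u') * Real.sin_sq_add_cos_sq (u x)

namespace IsProfile

variable {m₁ m₂ L : ℝ} {φ : ℝ → ℝ}

theorem pos_right (hm₁ : 0 < m₁) (hφ : IsProfile m₁ m₂ L φ) : 0 < m₂ :=
  hm₁.trans_le (hφ.le_period.trans hφ.period_le)

theorem sin_ne_zero (hm₁ : 0 < m₁) (hφ : IsProfile m₁ m₂ L φ) (α : ℝ) {h : ℝ}
    (hh : h ∈ Ioc (0 : ℝ) (1 / 2)) :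
    Real.sin (Real.pi * (φ α - φ (α + h)) / L) ≠ 0 := by
  have hm₂ := hφ.pos_right hm₁
  have h0 : 0 < h := hh.1
  exact abs_pos.1 (lt_of_lt_of_le (by positivity) (hφ.abs_sin_lower hm₁ hh.1.le hh.2))

theorem sin_ne_zero' (hm₁ : 0 < m₁) (hφ : IsProfile m₁ m₂ L φ) (α : ℝ) {h : ℝ}
    (hh : h ∈ Ioc (0 : ℝ) (1 / 2)) :
    Real.sin (Real.pi * (φ α - φ (α - h)) / L) ≠ 0 := by
  have hm₂ := hφ.pos_right hm₁
  have h0 : 0 < h := hh.1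
  exact abs_pos.1 (lt_of_lt_of_le (by positivity) (hφ.abs_sin_lower' hm₁ hh.1.le hh.2))

theorem continuousOn_cot_add (hm₁ : 0 < m₁) (hφ : IsProfile m₁ m₂ L φ) (α : ℝ) :
    ContinuousOn (fun h => Real.cot (Real.pi * (φ α - φ (α + h)) / L)) (Ioc 0 (1 / 2)) := by
  have hc := hφ.continuous
  simp only [Real.cot_eq_cos_div_sin]
  exact ContinuousOn.div (by fun_prop) (by fun_prop) fun h hh => hφ.sin_ne_zero hm₁ α hh

theorem continuousOn_cot_sub (hm₁ : 0 < m₁) (hφ : IsProfile m₁ m₂ L φ) (α : ℝ) :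
    ContinuousOn (fun h => Real.cot (Real.pi * (φ α - φ (α - h)) / L)) (Ioc 0 (1 / 2)) := by
  have hc := hφ.continuous
  simp only [Real.cot_eq_cos_div_sin]
  exact ContinuousOn.div (by fun_prop) (by fun_prop) fun h hh => hφ.sin_ne_zero' hm₁ α hh

theorem intervalIntegrable_cot (hm₁ : 0 < m₁) (hφ : IsProfile m₁ m₂ L φ) (α : ℝ) :
    IntervalIntegrable (fun h => Real.cot (Real.pi * (φ α - φ (α + h)) / L)
      + Real.cot (Real.pi * (φ α - φ (α - h)) / L)) volume 0 (1 / 2) := by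
  have hm₂ := hφ.pos_right hm₁
  refine intervalIntegrable_of_continuousOn_Ioc (by norm_num)
    ((hφ.continuousOn_cot_add hm₁ α).add (hφ.continuousOn_cot_sub hm₁ α))
    (b := fun _ => 2 * Real.pi * m₂ / m₁ / (2 * m₁ / m₂) ^ 2) intervalIntegrable_const ?_
  intro h hh
  exact abs_cot_add_cot_le hh.1 (by positivity) (hφ.abs_sin_lower hm₁ hh.1.le hh.2)
    (hφ.abs_sin_lower' hm₁ hh.1.le hh.2) (hφ.abs_angle_add_le hm₁ hh.1.le)

theorem pvPeriod_cot (hm₁ : 0 < m₁) (hφ : IsProfile m₁ m₂ L φ) (α : ℝ) :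
    pvPeriod (fun β => Real.cot (Real.pi * (φ α - φ β) / L)) α
      = ∫ h in (0 : ℝ)..(1 / 2), (Real.cot (Real.pi * (φ α - φ (α + h)) / L)
        + Real.cot (Real.pi * (φ α - φ (α - h)) / L)) :=
  pvPeriod_eq_integral (hφ.continuousOn_cot_add hm₁ α) (hφ.continuousOn_cot_sub hm₁ α)
    (hφ.intervalIntegrable_cot hm₁ α)

/-- For fixed `h`, differentiating in the base point gives two `csc²` terms weighted by the
differences of `φ_α`. Their sum is `O(h²)`, by the bound on the third derivative, and each one is
`O(h)`, so the singularity cancels and the mean value inequality applies uniformly in `h`. -/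
theorem abs_cot_kernel_sub_le (hm₁ : 0 < m₁) (hφ : IsProfile m₁ m₂ L φ) {h : ℝ}
    (hh : h ∈ Ioc (0 : ℝ) (1 / 2)) {c k : ℝ} (hc : c = 2 * m₁ / m₂)
    (hk : k = 2 * Real.pi * m₂ / m₁) (a b : ℝ) :
    |(Real.cot (Real.pi * (φ a - φ (a + h)) / L) + Real.cot (Real.pi * (φ a - φ (a - h)) / L))
      - (Real.cot (Real.pi * (φ b - φ (b + h)) / L) + Real.cot (Real.pi * (φ b - φ (b - h)) / L))|
      ≤ (k / c ^ 2 + k ^ 3 / c ^ 4) * |a - b| := by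
  have hm₂ := hφ.pos_right hm₁
  have hpi := Real.pi_pos
  have hc0 : 0 < c := by rw [hc]; positivity
  have hk0 : 0 < k := by rw [hk]; positivity
  have h0 : 0 < h := hh.1
  have hd : ∀ α : ℝ, HasDerivAt (fun α => Real.cot (Real.pi * (φ α - φ (α + h)) / L)
      + Real.cot (Real.pi * (φ α - φ (α - h)) / L))
      (-(1 / Real.sin (Real.pi * (φ α - φ (α + h)) / L) ^ 2
          * (Real.pi * (deriv φ α - deriv φ (α + h)) / L))
        + -(1 / Real.sin (Real.pi * (φ α - φ (α - h)) / L) ^ 2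
          * (Real.pi * (deriv φ α - deriv φ (α - h)) / L))) α := by
    intro α
    have e0 := (hφ.differentiable α).hasDerivAt
    have e1 := (hφ.differentiable (α + h)).hasDerivAt.comp_add_const α h
    have e2 := (hφ.differentiable (α - h)).hasDerivAt.comp_sub_const α h
    exact (hasDerivAt_cot_comp (((e0.sub e1).const_mul Real.pi).div_const L)
      (hφ.sin_ne_zero hm₁ α hh)).add (hasDerivAt_cot_comp
        (((e0.sub e2).const_mul Real.pi).div_const L) (hφ.sin_ne_zero' hm₁ α hh))
  have := Convex.norm_image_sub_le_of_norm_hasDerivWithin_le (s := univ)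
    (C := k / c ^ 2 + k ^ 3 / c ^ 4)
    (fun x _ => (hd x).hasDerivWithinAt) ?_ convex_univ (mem_univ b) (mem_univ a)
  · simpa only [Real.norm_eq_abs] using this
  intro α _
  rw [← neg_add, norm_neg, Real.norm_eq_abs]
  subst hc hk
  refine (abs_inv_sin_sq_mul_add_le h0 hc0 (hφ.abs_sin_lower hm₁ hh.1.le hh.2)
    (hφ.abs_sin_lower' hm₁ hh.1.le hh.2) (hφ.abs_angle_add_le hm₁ hh.1.le)
    (hφ.abs_angle_sub_le hm₁ hh.1.le) _ _).trans ?_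
  gcongr ?_ + ?_
  · rw [div_le_div_iff₀ (by positivity) (by positivity)]
    have := hφ.abs_angle_deriv_add_le hm₁ (α := α) h0.le
    calc _ ≤ (2 * Real.pi * m₂ / m₁ * h ^ 2) * (2 * m₁ / m₂) ^ 2 := by gcongr
      _ = _ := by ring
  · rw [div_le_div_iff₀ (by positivity) (by positivity)]
    have := hφ.abs_angle_deriv_le hm₁ (α := α) h0.le
    calc _ ≤ (2 * Real.pi * m₂ / m₁) ^ 2 * (2 * Real.pi * m₂ / m₁ * h) * (2 * m₁ / m₂) ^ 4 := by
          gcongr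
      _ = _ := by ring

theorem abs_pvPeriod_cot_sub_le (hm₁ : 0 < m₁) (hφ : IsProfile m₁ m₂ L φ) {c k : ℝ}
    (hc : c = 2 * m₁ / m₂) (hk : k = 2 * Real.pi * m₂ / m₁) (a b : ℝ) :
    |pvPeriod (fun β => Real.cot (Real.pi * (φ a - φ β) / L)) a
      - pvPeriod (fun β => Real.cot (Real.pi * (φ b - φ β) / L)) b|
      ≤ (k / c ^ 2 + k ^ 3 / c ^ 4) * |a - b| := by
  have hm₂ := hφ.pos_right hm₁
  have hpi := Real.pi_pos
  have hc0 : 0 < c := by rw [hc]; positivity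
  have hk0 : 0 < k := by rw [hk]; positivity
  rw [hφ.pvPeriod_cot hm₁, hφ.pvPeriod_cot hm₁, ← intervalIntegral.integral_sub
    (hφ.intervalIntegrable_cot hm₁ a) (hφ.intervalIntegrable_cot hm₁ b)]
  rw [← Real.norm_eq_abs]
  refine (intervalIntegral.norm_integral_le_of_norm_le_const
    (C := (k / c ^ 2 + k ^ 3 / c ^ 4) * |a - b|) (fun h hh => ?_)).trans ?_
  · rw [uIoc_of_le (by norm_num)] at hh
    exact hφ.abs_cot_kernel_sub_le hm₁ hh hc hk a b
  have h2 : |(1 / 2 : ℝ) - 0| ≤ 1 := by rw [abs_le]; constructor <;> norm_num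
  exact mul_le_of_le_one_right (by positivity) h2

theorem neg_deriv_lower (hφ : IsProfile m₁ m₂ L φ) (α : ℝ) : m₁ ≤ |deriv φ α| := by
  have := hφ.deriv_le α
  have := neg_le_abs (deriv φ α)
  linarith

theorem deriv_ne_zero (hm₁ : 0 < m₁) (hφ : IsProfile m₁ m₂ L φ) (α : ℝ) : deriv φ α ≠ 0 :=
  abs_pos.1 (hm₁.trans_le (hφ.neg_deriv_lower α))

end IsProfile

theorem abs_div_pow_le {a b A m : ℝ} (n : ℕ) (hm : 0 < m) (ha : |a| ≤ A) (hb : m ≤ |b|) :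
    |a / b ^ n| ≤ A / m ^ n := by
  rw [abs_div, abs_pow]
  exact div_le_div₀ ((abs_nonneg _).trans ha) ha (by positivity) (pow_le_pow_left₀ hm.le hb n)

theorem exists_abs_deriv_potential_le (m₁ m₂ : ℝ) (hm₁ : 0 < m₁) :
    ∃ C, ∀ L φ, IsProfile m₁ m₂ L φ → ∀ α, |deriv (potential L φ) α| ≤ C := by
  obtain ⟨c, hc⟩ : ∃ c, c = 2 * m₁ / m₂ := ⟨_, rfl⟩
  obtain ⟨k, hk⟩ : ∃ k, k = 2 * Real.pi * m₂ / m₁ := ⟨_, rfl⟩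
  refine ⟨(m₂ / m₁ ^ 2 + 2 * (m₂ ^ 2 / m₁ ^ 3)) + 3 * (m₂ / m₁ ^ 4 + 4 * (m₂ ^ 2 / m₁ ^ 5))
    + 2 * Real.pi / m₁ ^ 2 * (k / c ^ 2 + k ^ 3 / c ^ 4), fun L φ hφ α => ?_⟩
  have hm₂ := hφ.pos_right hm₁
  have hpi := Real.pi_pos
  have hc0 : 0 < c := by rw [hc]; positivity
  have hk0 : 0 < k := by rw [hk]; positivity
  have hquot : ∀ n : ℕ, ∀ x, HasDerivAt (fun y => deriv (deriv φ) y / deriv φ y ^ n)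
      (deriv (deriv (deriv φ)) x / deriv φ x ^ n
        - n * (deriv (deriv φ) x ^ 2 / deriv φ x ^ (n + 1))) x := by
    intro n x
    have h0 := hφ.deriv_ne_zero hm₁ x
    have := (hφ.differentiable_deriv_deriv x).hasDerivAt.div
      ((hφ.differentiable_deriv x).hasDerivAt.pow n) (pow_ne_zero n h0)
    refine this.congr_deriv ?_
    -- The power rule contains the natural-number exponent `n - 1`, so `n = 0` is treated apart.
    rcases n with _ | n
    · simp
    · simp only [Nat.add_sub_cancel, Pi.pow_apply]
      field_simp
      ring
  have hquot_le : ∀ n : ℕ, ∀ x, |deriv (deriv (deriv φ)) x / deriv φ x ^ n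
        - n * (deriv (deriv φ) x ^ 2 / deriv φ x ^ (n + 1))|
        ≤ m₂ / m₁ ^ n + n * (m₂ ^ 2 / m₁ ^ (n + 1)) := by
    intro n x
    refine (abs_sub _ _).trans (add_le_add ?_ ?_)
    · exact abs_div_pow_le n hm₁ (hφ.abs_third x) (hφ.neg_deriv_lower x)
    · rw [abs_mul, Nat.abs_cast]
      gcongr
      refine abs_div_pow_le _ hm₁ ?_ (hφ.neg_deriv_lower x)
      rw [abs_pow]
      exact pow_le_pow_left₀ (abs_nonneg _) (hφ.abs_second x) 2
  have hlip : ∀ n : ℕ, ∀ a b, |deriv (deriv φ) a / deriv φ a ^ n - deriv (deriv φ) b / deriv φ b ^ n|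
      ≤ (m₂ / m₁ ^ n + n * (m₂ ^ 2 / m₁ ^ (n + 1))) * |a - b| := by
    intro n a b
    have := Convex.norm_image_sub_le_of_norm_hasDerivWithin_le (s := univ)
      (fun x _ => (hquot n x).hasDerivWithinAt) (fun x _ => hquot_le n x) convex_univ
      (mem_univ b) (mem_univ a)
    simpa only [Real.norm_eq_abs] using this
  rw [← Real.norm_eq_abs]
  -- A Lipschitz bound controls `deriv` whether or not the potential is differentiable, so the
  -- principal value never has to be differentiated.
  refine norm_deriv_le_of_lip' (by positivity) (Eventually.of_forall fun x => ?_)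
  simp only [Real.norm_eq_abs, potential, iteratedDeriv_succ, iteratedDeriv_zero]
  have h2 := hlip 2 x α
  have h4 := hlip 4 x α
  have hcot := hφ.abs_pvPeriod_cot_sub_le hm₁ hc hk x α
  set p := pvPeriod (fun β => Real.cot (Real.pi * (φ x - φ β) / L)) x
  set q := pvPeriod (fun β => Real.cot (Real.pi * (φ α - φ β) / L)) α
  have hL := hφ.le_period
  have h3 : |2 * Real.pi / L ^ 2 * (p - q)|
      ≤ 2 * Real.pi / m₁ ^ 2 * (k / c ^ 2 + k ^ 3 / c ^ 4) * |x - α| := by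
    rw [abs_mul, abs_of_nonneg (by positivity), mul_assoc]
    gcongr
  push_cast at h2 h4
  calc _ = |-(deriv (deriv φ) x / deriv φ x ^ 2 - deriv (deriv φ) α / deriv φ α ^ 2)
        + -(3 * (deriv (deriv φ) x / deriv φ x ^ 4 - deriv (deriv φ) α / deriv φ α ^ 4))
        + 2 * Real.pi / L ^ 2 * (p - q)| := by congr 1; ring
    _ ≤ |deriv (deriv φ) x / deriv φ x ^ 2 - deriv (deriv φ) α / deriv φ α ^ 2|
        + 3 * |deriv (deriv φ) x / deriv φ x ^ 4 - deriv (deriv φ) α / deriv φ α ^ 4|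
        + |2 * Real.pi / L ^ 2 * (p - q)| := by
        refine (abs_add_three _ _ _).trans_eq ?_
        rw [abs_neg, abs_neg, abs_mul, abs_of_pos (by norm_num : (0 : ℝ) < 3)]
    _ ≤ _ := by nlinarith

/-! ### The Cauchy-Schwarz inequality for integrals of real functions -/

/-- The quadratic `r ↦ ∫ (f + r g)²` is nonnegative, so its discriminant is at most zero. -/
theorem sq_integral_mul_le {X : Type*} [MeasurableSpace X] {μ : Measure X} {f g : X → ℝ}
    (hf : MemLp f 2 μ) (hg : MemLp g 2 μ) :
    (∫ x, f x * g x ∂μ) ^ 2 ≤ (∫ x, f x ^ 2 ∂μ) * ∫ x, g x ^ 2 ∂μ := by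
  have hfg : Integrable (fun x => f x * g x) μ := hf.integrable_mul hg
  have key : ∀ r : ℝ, 0 ≤ (∫ x, g x ^ 2 ∂μ) * (r * r) + (2 * ∫ x, f x * g x ∂μ) * r
      + ∫ x, f x ^ 2 ∂μ := by
    intro r
    have h0 : 0 ≤ ∫ x, (f x + r * g x) ^ 2 ∂μ := integral_nonneg fun x => sq_nonneg _
    have h1 := hfg.const_mul (2 * r)
    have h2 := hg.integrable_sq.const_mul (r ^ 2)
    have h12 : Integrable (fun x => (2 * r) * (f x * g x) + r ^ 2 * g x ^ 2) μ := h1.add h2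
    have e : ∫ x, (f x + r * g x) ^ 2 ∂μ
        = ∫ x, (f x ^ 2 + ((2 * r) * (f x * g x) + r ^ 2 * g x ^ 2)) ∂μ := by
      congr 1; funext x; ring
    rw [e, integral_add hf.integrable_sq h12, integral_add h1 h2, integral_const_mul,
      integral_const_mul] at h0
    linarith
  have := discrim_le_zero key
  rw [discrim] at this
  linarith

theorem memLp_two_restrict_Ioc {f : ℝ → ℝ} {a b : ℝ} (hf : ContinuousOn f (Icc a b)) :
    MemLp f 2 (volume.restrict (Ioc a b)) := by
  obtain ⟨C, hC⟩ := isCompact_Icc.exists_bound_of_continuousOn hf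
  refine MemLp.of_bound ((hf.mono Ioc_subset_Icc_self).aestronglyMeasurable measurableSet_Ioc) C ?_
  exact (ae_restrict_iff' measurableSet_Ioc).2 (ae_of_all _ fun x hx => hC x (Ioc_subset_Icc_self hx))

theorem unitMeasure_eq : unitMeasure = volume.restrict (Ioc (0 : ℝ) 1) :=
  Measure.restrict_congr_set Ioc_ae_eq_Icc.symm

instance : IsProbabilityMeasure unitMeasure := ⟨by simp [unitMeasure]⟩

theorem intervalIntegral_eq_unit (f : ℝ → ℝ) : ∫ x in (0 : ℝ)..1, f x = ∫ x, f x ∂unitMeasure := by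
  rw [intervalIntegral.integral_of_le zero_le_one, unitMeasure_eq]

/-! ### Periodic functions with square integrable second derivative -/

theorem iteratedDeriv_two (f : ℝ → ℝ) : iteratedDeriv 2 f = deriv (deriv f) := by
  rw [iteratedDeriv_succ, iteratedDeriv_one]

theorem periodic_deriv {f : ℝ → ℝ} (hf : Function.Periodic f 1) :
    Function.Periodic (deriv f) 1 := by
  intro x
  rw [← deriv_comp_add_const]
  congr 1
  funext y
  exact hf y

namespace MemH2Per

variable {ψ : ℝ → ℝ}

theorem differentiable (hψ : MemH2Per ψ) : Differentiable ℝ ψ :=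
  hψ.2.1.differentiable (by norm_num)

theorem continuous_deriv (hψ : MemH2Per ψ) : Continuous (deriv ψ) :=
  hψ.2.1.continuous_deriv (by norm_num)

theorem continuous (hψ : MemH2Per ψ) : Continuous ψ := hψ.2.1.continuous

theorem memLp_deriv_deriv (hψ : MemH2Per ψ) : MemLp (deriv (deriv ψ)) 2 unitMeasure := by
  rw [← iteratedDeriv_two]
  exact hψ.2.2.2

theorem intervalIntegrable_sq (hψ : MemH2Per ψ) (a b : ℝ) :
    IntervalIntegrable (fun x => deriv (deriv ψ) x ^ 2) volume a b := by
  have hper : Function.Periodic (fun x => deriv (deriv ψ) x ^ 2) 1 := fun x => by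
    simp only [periodic_deriv (periodic_deriv hψ.1) x]
  refine hper.intervalIntegrable (t := 0) one_ne_zero ?_ a b
  rw [zero_add, intervalIntegrable_iff_integrableOn_Ioc_of_le zero_le_one]
  have := hψ.memLp_deriv_deriv.integrable_sq
  rwa [unitMeasure_eq] at this

theorem memLp_Ioc (hψ : MemH2Per ψ) {a b : ℝ} (hab : a ≤ b) :
    MemLp (deriv (deriv ψ)) 2 (volume.restrict (Ioc a b)) := by
  rw [memLp_two_iff_integrable_sq (measurable_deriv _).aestronglyMeasurable]
  exact (intervalIntegrable_iff_integrableOn_Ioc_of_le hab).1 (hψ.intervalIntegrable_sq a b)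

theorem integral_sq_le (hψ : MemH2Per ψ) {a b : ℝ} (hb : b ≤ a + 1) :
    ∫ x in Ioc a b, deriv (deriv ψ) x ^ 2 ≤ ∫ x in (0 : ℝ)..1, deriv (deriv ψ) x ^ 2 := by
  have hper : Function.Periodic (fun x => deriv (deriv ψ) x ^ 2) 1 := fun x => by
    simp only [periodic_deriv (periodic_deriv hψ.1) x]
  have h := hper.intervalIntegral_add_eq a 0
  rw [zero_add] at h
  rw [← h, intervalIntegral.integral_of_le (by linarith)]
  refine setIntegral_mono_set ?_ (ae_of_all _ fun x => sq_nonneg _)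
    (Ioc_subset_Ioc_right hb).eventuallyLE
  exact (intervalIntegrable_iff_integrableOn_Ioc_of_le (by linarith)).1
    (hψ.intervalIntegrable_sq a (a + 1))

theorem sq_deriv_sub_le (hψ : MemH2Per ψ) {a b : ℝ} (hab : a ≤ b) (hb : b ≤ a + 1) :
    (deriv ψ b - deriv ψ a) ^ 2 ≤ (b - a) * ∫ x in (0 : ℝ)..1, deriv (deriv ψ) x ^ 2 := by
  rw [← (hψ.2.2.1 a b).integral_deriv_eq_sub, intervalIntegral.integral_of_le hab]
  have h := sq_integral_mul_le (memLp_const (1 : ℝ)) (hψ.memLp_Ioc hab)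
  simp only [one_mul, one_pow] at h
  refine h.trans ?_
  have e : ∫ _ in Ioc a b, (1 : ℝ) = b - a := by simp [hab]
  rw [e]
  exact mul_le_mul_of_nonneg_left (hψ.integral_sq_le hb) (by linarith)

theorem exists_deriv_eq_zero (hψ : MemH2Per ψ) : ∃ a, deriv ψ a = 0 := by
  obtain ⟨a, -, ha⟩ := _root_.exists_deriv_eq_zero (f := ψ) (zero_lt_one' ℝ)
    hψ.continuous.continuousOn (by simpa using (hψ.1 0).symm)
  exact ⟨a, ha⟩

theorem integral_nonneg_sq (ψ : ℝ → ℝ) : 0 ≤ ∫ x in (0 : ℝ)..1, ψ x ^ 2 :=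
  intervalIntegral.integral_nonneg zero_le_one fun _ _ => sq_nonneg _

/-- By Rolle and periodicity `ψ_α` has a zero within one period to the left of a translate of any
point; the Hölder bound is applied from there. -/
theorem sq_deriv_le (hψ : MemH2Per ψ) (x : ℝ) :
    deriv ψ x ^ 2 ≤ ∫ x in (0 : ℝ)..1, deriv (deriv ψ) x ^ 2 := by
  obtain ⟨a, ha⟩ := hψ.exists_deriv_eq_zero
  obtain ⟨y, hy, hxy⟩ := (periodic_deriv hψ.1).exists_mem_Ico zero_lt_one x a
  have h := hψ.sq_deriv_sub_le hy.1 hy.2.le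
  rw [ha, sub_zero] at h
  rw [hxy]
  refine h.trans (mul_le_of_le_one_left (integral_nonneg_sq _) (by linarith [hy.2]))

theorem sq_integral_deriv_sq_le (hψ : MemH2Per ψ) :
    (∫ x in (0 : ℝ)..1, deriv ψ x ^ 2) ^ 2
      ≤ (∫ x in (0 : ℝ)..1, ψ x ^ 2) * ∫ x in (0 : ℝ)..1, deriv (deriv ψ) x ^ 2 := by
  have hac : AbsolutelyContinuousOnInterval ψ 0 1 :=
    hψ.2.1.contDiffOn.absolutelyContinuousOnInterval
  have h := (hψ.2.2.1 0 1).integral_mul_deriv_eq_deriv_mul hac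
  have e0 : deriv ψ 1 = deriv ψ 0 := by simpa using periodic_deriv hψ.1 0
  have e1 : ψ 1 = ψ 0 := by simpa using hψ.1 0
  rw [e0, e1, sub_self, zero_sub] at h
  have h2 : ∫ x in (0 : ℝ)..1, deriv ψ x ^ 2 = ∫ x in (0 : ℝ)..1, deriv ψ x * deriv ψ x := by
    simp only [sq]
  rw [h2, h, neg_sq]
  simp only [intervalIntegral_eq_unit]
  rw [mul_comm]
  refine sq_integral_mul_le hψ.memLp_deriv_deriv ?_
  rw [unitMeasure_eq]
  exact memLp_two_restrict_Ioc hψ.continuous.continuousOn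

/-- Starting from a zero of `ψ_α`, one has `ψ_α² = 2 ∫ ψ_α ψ_αα`; then Cauchy-Schwarz. -/
theorem deriv_pow_four_le (hψ : MemH2Per ψ) (x : ℝ) :
    deriv ψ x ^ 4 ≤ 4 * ((∫ x in (0 : ℝ)..1, deriv ψ x ^ 2)
      * ∫ x in (0 : ℝ)..1, deriv (deriv ψ) x ^ 2) := by
  obtain ⟨a, ha⟩ := hψ.exists_deriv_eq_zero
  obtain ⟨y, hy, hxy⟩ := (periodic_deriv hψ.1).exists_mem_Ico zero_lt_one x a
  have hac := hψ.2.2.1 a y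
  have h := hac.integral_mul_deriv_eq_deriv_mul hac
  have e : ∫ x in a..y, deriv (deriv ψ) x * deriv ψ x
      = ∫ x in a..y, deriv ψ x * deriv (deriv ψ) x := by simp only [mul_comm]
  rw [e, ha, mul_zero, sub_zero, intervalIntegral.integral_of_le hy.1] at h
  have hcs := sq_integral_mul_le (memLp_two_restrict_Ioc hψ.continuous_deriv.continuousOn)
    (hψ.memLp_Ioc hy.1)
  have h1 : ∫ x in Ioc a y, deriv ψ x ^ 2 ≤ ∫ x in (0 : ℝ)..1, deriv ψ x ^ 2 := by
    have hper : Function.Periodic (fun x => deriv ψ x ^ 2) 1 := fun x => by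
      simp only [periodic_deriv hψ.1 x]
    have h := hper.intervalIntegral_add_eq a 0
    rw [zero_add] at h
    rw [← h, intervalIntegral.integral_of_le (by linarith)]
    refine setIntegral_mono_set ?_ (ae_of_all _ fun x => sq_nonneg _)
      (Ioc_subset_Ioc_right hy.2.le).eventuallyLE
    exact (hψ.continuous_deriv.pow 2).integrableOn_Ioc
  have h2 := hψ.integral_sq_le hy.2.le
  have h3 : deriv ψ x ^ 4 = 4 * (∫ x in Ioc a y, deriv ψ x * deriv (deriv ψ) x) ^ 2 := by
    rw [hxy]
    have : deriv ψ y * deriv ψ y = 2 * ∫ x in Ioc a y, deriv ψ x * deriv (deriv ψ) x := by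
      linarith
    calc deriv ψ y ^ 4 = (deriv ψ y * deriv ψ y) ^ 2 := by ring
      _ = _ := by rw [this]; ring
  rw [h3]
  gcongr
  refine hcs.trans (mul_le_mul h1 h2 (integral_nonneg fun _ => sq_nonneg _) (integral_nonneg_sq _))

/-- A sup bound of the first derivative with its interpolation inequality. -/
theorem exists_deriv_bound (hψ : MemH2Per ψ) {N E : ℝ} (hN : N = ∫ x in (0 : ℝ)..1, ψ x ^ 2)
    (hE : E = ∫ x in (0 : ℝ)..1, deriv (deriv ψ) x ^ 2) :
    ∃ M, 0 ≤ M ∧ (∀ x, |deriv ψ x| ≤ M) ∧ M ^ 2 ≤ E ∧ M ^ 8 ≤ 16 * (N * E ^ 3) := by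
  obtain ⟨y, -, hy⟩ := isCompact_Icc.exists_isMaxOn (nonempty_Icc.2 (zero_le_one' ℝ))
    hψ.continuous_deriv.abs.continuousOn
  refine ⟨|deriv ψ y|, abs_nonneg _, fun x => ?_, ?_, ?_⟩
  · obtain ⟨z, hz, hxz⟩ := (periodic_deriv hψ.1).exists_mem_Ico₀ zero_lt_one x
    rw [hxz]
    exact hy (Ico_subset_Icc_self hz)
  · rw [sq_abs, hE]
    exact hψ.sq_deriv_le y
  · have h4 := hψ.deriv_pow_four_le y
    have h2 := hψ.sq_integral_deriv_sq_le
    rw [← hN, ← hE] at h2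
    rw [← hE] at h4
    have hE0 : 0 ≤ E := hE ▸ integral_nonneg_sq _
    set P := ∫ x in (0 : ℝ)..1, deriv ψ x ^ 2
    calc |deriv ψ y| ^ 8 = (deriv ψ y ^ 4) ^ 2 := by
          rw [← pow_mul, Even.pow_abs (by decide)]
      _ ≤ (4 * (P * E)) ^ 2 := by
          apply pow_le_pow_left₀ _ h4
          positivity
      _ = 16 * (P ^ 2 * E ^ 2) := by ring
      _ ≤ 16 * (N * E * E ^ 2) := by gcongr
      _ = _ := by ring

end MemH2Per

/-! ### The singular integral in the linearized potential -/

/-- The nonlocal term of `potentialVariation`. -/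
noncomputable def singularTerm (L : ℝ) (φ ψ : ℝ → ℝ) (α : ℝ) : ℝ :=
  pvPeriod (fun β => 1 / Real.sin (Real.pi * (φ α - φ β) / L) ^ 2 * (ψ α - ψ β)) α

/-- The symmetrized kernel of `singularTerm`. -/
noncomputable def singularKernel (L : ℝ) (φ ψ : ℝ → ℝ) (α h : ℝ) : ℝ :=
  1 / Real.sin (Real.pi * (φ α - φ (α + h)) / L) ^ 2 * (ψ α - ψ (α + h))
    + 1 / Real.sin (Real.pi * (φ α - φ (α - h)) / L) ^ 2 * (ψ α - ψ (α - h))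

section Singular

variable {m₁ m₂ L : ℝ} {φ ψ : ℝ → ℝ}

theorem abs_sub_le_of_deriv_bound (hψ : Differentiable ℝ ψ) {M : ℝ} (hM : ∀ x, |deriv ψ x| ≤ M)
    (a b : ℝ) : |ψ a - ψ b| ≤ M * |a - b| := by
  have := Convex.norm_image_sub_le_of_norm_deriv_le (s := univ) (C := M)
    (fun x _ => hψ x) (fun x _ => hM x) convex_univ (mem_univ b) (mem_univ a)
  simpa using this

/-- Geometric mean of the Lipschitz bound `2 M h` and the Hölder bound `√(2hE) h`, compared through
fourth powers. The exponent `5/4` exceeds `1`, which is what makes the quotient by `h²` integrable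
at zero. -/
theorem abs_second_difference_le_rpow (hψ : Differentiable ℝ ψ) {M E X h : ℝ} (hX : 0 ≤ X)
    (hM : ∀ x, |deriv ψ x| ≤ M)
    (hE : ∀ a b, a ≤ b → b ≤ a + 1 → (deriv ψ b - deriv ψ a) ^ 2 ≤ (b - a) * E)
    (hMX : M ^ 2 * E ≤ X ^ 4) (hh : h ∈ Ioc (0 : ℝ) (1 / 2)) (α : ℝ) :
    |(ψ α - ψ (α + h)) + (ψ α - ψ (α - h))| ≤ 2 * X * h ^ (5 / 4 : ℝ) := by
  have h0 : 0 < h := hh.1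
  have hE0 : 0 ≤ E := by
    have := hE 0 1 zero_le_one (by norm_num)
    nlinarith [sq_nonneg (deriv ψ 1 - deriv ψ 0)]
  have hM0 : 0 ≤ M := (abs_nonneg _).trans (hM 0)
  have b1 : |(ψ α - ψ (α + h)) + (ψ α - ψ (α - h))| ≤ 2 * M * h := by
    refine (abs_add_le _ _).trans ?_
    have e1 := abs_sub_le_of_deriv_bound hψ hM α (α + h)
    have e2 := abs_sub_le_of_deriv_bound hψ hM α (α - h)
    rw [sub_add_cancel_left, abs_neg, abs_of_pos h0] at e1
    rw [sub_sub_cancel, abs_of_pos h0] at e2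
    linarith
  have b2 : |(ψ α - ψ (α + h)) + (ψ α - ψ (α - h))| ≤ Real.sqrt (2 * h * E) * h := by
    refine abs_second_difference_le hψ h0.le fun u hu => Real.abs_le_sqrt ?_
    refine (hE (α - u) (α + u) (by linarith [hu.1]) (by linarith [hu.2, hh.2])).trans ?_
    gcongr
    linarith [hu.2]
  set Y := |(ψ α - ψ (α + h)) + (ψ α - ψ (α - h))|
  have hY : 0 ≤ Y := abs_nonneg _
  have hr : (h ^ (5 / 4 : ℝ)) ^ 4 = h ^ 5 := by
    rw [← Real.rpow_natCast, ← Real.rpow_mul h0.le, ← Real.rpow_natCast h 5]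
    norm_num
  refine le_of_pow_le_pow_left₀ (n := 4) (by norm_num) (by positivity) ?_
  calc Y ^ 4 = Y ^ 2 * Y ^ 2 := by ring
    _ ≤ (2 * M * h) ^ 2 * (Real.sqrt (2 * h * E) * h) ^ 2 := by gcongr
    _ = 8 * (M ^ 2 * E) * h ^ 5 := by
        rw [mul_pow (Real.sqrt _), Real.sq_sqrt (by positivity)]; ring
    _ ≤ 16 * X ^ 4 * h ^ 5 := by
        gcongr
        · norm_num
    _ = _ := by rw [mul_pow, hr]; ring

theorem abs_singularKernel_le (hm₁ : 0 < m₁) (hφ : IsProfile m₁ m₂ L φ)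
    (hψ : Differentiable ℝ ψ) {M E X h c k : ℝ} (hc : c = 2 * m₁ / m₂)
    (hk : k = 2 * Real.pi * m₂ / m₁) (hX : 0 ≤ X) (hM : ∀ x, |deriv ψ x| ≤ M)
    (hE : ∀ a b, a ≤ b → b ≤ a + 1 → (deriv ψ b - deriv ψ a) ^ 2 ≤ (b - a) * E)
    (hMX : M ^ 2 * E ≤ X ^ 4) (hMX' : M ≤ X) (hh : h ∈ Ioc (0 : ℝ) (1 / 2)) (α : ℝ) :
    |singularKernel L φ ψ α h| ≤ (2 / c ^ 2 + k ^ 2 / c ^ 4) * X * h ^ (-(3 / 4) : ℝ) := by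
  have hm₂ := hφ.pos_right hm₁
  have hpi := Real.pi_pos
  have hc0 : 0 < c := by rw [hc]; positivity
  have hk0 : 0 < k := by rw [hk]; positivity
  have h0 : 0 < h := hh.1
  have hM0 : 0 ≤ M := (abs_nonneg _).trans (hM 0)
  have h1 := abs_second_difference_le_rpow hψ hX hM hE hMX hh α
  have h2 := abs_sub_le_of_deriv_bound hψ hM α (α - h)
  rw [sub_sub_cancel, abs_of_pos h0] at h2
  have key := abs_inv_sin_sq_mul_add_le h0 (by positivity) (hφ.abs_sin_lower hm₁ hh.1.le hh.2)
    (hφ.abs_sin_lower' hm₁ hh.1.le hh.2) (hφ.abs_angle_add_le hm₁ hh.1.le)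
    (hφ.abs_angle_sub_le (α := α) hm₁ hh.1.le) (ψ α - ψ (α + h)) (ψ α - ψ (α - h))
  rw [← hc, ← hk] at key
  have hone : 1 ≤ h ^ (-(3 / 4) : ℝ) :=
    Real.one_le_rpow_of_pos_of_le_one_of_nonpos h0 (by linarith [hh.2]) (by norm_num)
  have hpow : h ^ (5 / 4 : ℝ) = h ^ (-(3 / 4) : ℝ) * h ^ 2 := by
    rw [← Real.rpow_natCast h 2, ← Real.rpow_add h0]
    norm_num
  refine key.trans ?_
  calc _ ≤ 2 * X * h ^ (5 / 4 : ℝ) / (c ^ 2 * h ^ 2) + k ^ 2 * (M * h) / (c ^ 4 * h) := by gcongr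
    _ = 2 / c ^ 2 * X * h ^ (-(3 / 4) : ℝ) + k ^ 2 / c ^ 4 * (M * 1) := by
        rw [hpow]; field_simp
    _ ≤ 2 / c ^ 2 * X * h ^ (-(3 / 4) : ℝ) + k ^ 2 / c ^ 4 * (X * h ^ (-(3 / 4) : ℝ)) := by gcongr
    _ = _ := by ring

theorem continuousOn_singular_add (hm₁ : 0 < m₁) (hφ : IsProfile m₁ m₂ L φ) (hψ : Continuous ψ)
    (α : ℝ) : ContinuousOn (fun h => 1 / Real.sin (Real.pi * (φ α - φ (α + h)) / L) ^ 2
      * (ψ α - ψ (α + h))) (Ioc 0 (1 / 2)) := by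
  have hc := hφ.continuous
  refine ContinuousOn.mul (ContinuousOn.div (by fun_prop) (by fun_prop) fun h hh => ?_)
    (by fun_prop)
  exact pow_ne_zero 2 (hφ.sin_ne_zero hm₁ α hh)

theorem continuousOn_singular_sub (hm₁ : 0 < m₁) (hφ : IsProfile m₁ m₂ L φ) (hψ : Continuous ψ)
    (α : ℝ) : ContinuousOn (fun h => 1 / Real.sin (Real.pi * (φ α - φ (α - h)) / L) ^ 2
      * (ψ α - ψ (α - h))) (Ioc 0 (1 / 2)) := by
  have hc := hφ.continuous
  refine ContinuousOn.mul (ContinuousOn.div (by fun_prop) (by fun_prop) fun h hh => ?_)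
    (by fun_prop)
  exact pow_ne_zero 2 (hφ.sin_ne_zero' hm₁ α hh)

theorem intervalIntegrable_rpow_weight (K : ℝ) :
    IntervalIntegrable (fun h : ℝ => K * h ^ (-(3 / 4) : ℝ)) volume 0 (1 / 2) :=
  (intervalIntegral.intervalIntegrable_rpow' (by norm_num)).const_mul K

theorem integral_rpow_weight_le {K : ℝ} (hK : 0 ≤ K) :
    ∫ h in (0 : ℝ)..(1 / 2), K * h ^ (-(3 / 4) : ℝ) ≤ 4 * K := by
  rw [intervalIntegral.integral_const_mul, integral_rpow (Or.inl (by norm_num))]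
  have h1 : (1 / 2 : ℝ) ^ (-(3 / 4) + 1 : ℝ) ≤ 1 :=
    Real.rpow_le_one (by norm_num) (by norm_num) (by norm_num)
  have h2 : (0 : ℝ) ^ (-(3 / 4) + 1 : ℝ) = 0 := Real.zero_rpow (by norm_num)
  rw [h2]
  have : ((1 / 2 : ℝ) ^ (-(3 / 4) + 1 : ℝ) - 0) / (-(3 / 4) + 1) ≤ 4 := by
    rw [div_le_iff₀ (by norm_num)]
    linarith
  nlinarith

theorem singularTerm_eq_and_abs_le (hm₁ : 0 < m₁) (hφ : IsProfile m₁ m₂ L φ)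
    (hψ : Differentiable ℝ ψ) {M E X c k : ℝ} (hc : c = 2 * m₁ / m₂)
    (hk : k = 2 * Real.pi * m₂ / m₁) (hX : 0 ≤ X) (hM : ∀ x, |deriv ψ x| ≤ M)
    (hE : ∀ a b, a ≤ b → b ≤ a + 1 → (deriv ψ b - deriv ψ a) ^ 2 ≤ (b - a) * E)
    (hMX : M ^ 2 * E ≤ X ^ 4) (hMX' : M ≤ X) (α : ℝ) :
    singularTerm L φ ψ α = ∫ h in (0 : ℝ)..(1 / 2), singularKernel L φ ψ α h ∧
      |singularTerm L φ ψ α| ≤ 4 * (2 / c ^ 2 + k ^ 2 / c ^ 4) * X := by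
  have hb := fun h hh => abs_singularKernel_le (h := h) hm₁ hφ hψ hc hk hX hM hE hMX hMX' hh α
  have c1 := continuousOn_singular_add hm₁ hφ hψ.continuous α
  have c2 := continuousOn_singular_sub hm₁ hφ hψ.continuous α
  have e : singularTerm L φ ψ α = ∫ h in (0 : ℝ)..(1 / 2), singularKernel L φ ψ α h :=
    pvPeriod_eq_integral c1 c2 (intervalIntegrable_of_continuousOn_Ioc (by norm_num) (c1.add c2)
      (intervalIntegrable_rpow_weight _) hb)
  refine ⟨e, ?_⟩
  rw [e, ← Real.norm_eq_abs]
  refine (intervalIntegral.norm_integral_le_of_norm_le (by norm_num) (ae_of_all _ hb)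
    (intervalIntegrable_rpow_weight _)).trans ?_
  have hm₂ := hφ.pos_right hm₁
  have hc0 : 0 < c := by rw [hc]; positivity
  refine (integral_rpow_weight_le (by positivity)).trans_eq (by ring)

theorem measurable_integral_singularKernel (hφ : Continuous φ) (hψ : Continuous ψ) (L : ℝ) :
    Measurable fun α => ∫ h in (0 : ℝ)..(1 / 2), singularKernel L φ ψ α h := by
  have hφ' := hφ.measurable
  have hψ' := hψ.measurable
  simp only [intervalIntegral.integral_of_le (by norm_num : (0 : ℝ) ≤ 1 / 2)]
  refine (StronglyMeasurable.integral_prod_right (f := fun α h => singularKernel L φ ψ α h)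
    ?_).measurable
  refine Measurable.stronglyMeasurable ?_
  unfold Function.uncurry singularKernel
  fun_prop

end Singular

theorem exists_singularTerm_bound (m₁ m₂ : ℝ) (hm₁ : 0 < m₁) (hm₂ : 0 < m₂) :
    ∃ s, 0 ≤ s ∧ ∀ L φ ψ, IsProfile m₁ m₂ L φ → MemH2Per ψ →
      ∀ N E, N = ∫ x in (0 : ℝ)..1, ψ x ^ 2 → E = ∫ x in (0 : ℝ)..1, deriv (deriv ψ) x ^ 2 →
      ∃ X, 0 ≤ X ∧ X ^ 2 ≤ E ∧ X ^ 16 ≤ 16 * (N * E ^ 7) ∧ (∀ x, |deriv ψ x| ≤ X) ∧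
        Measurable (singularTerm L φ ψ) ∧ ∀ x, |singularTerm L φ ψ x| ≤ s * X := by
  obtain ⟨c, hc⟩ : ∃ c, c = 2 * m₁ / m₂ := ⟨_, rfl⟩
  obtain ⟨k, hk⟩ : ∃ k, k = 2 * Real.pi * m₂ / m₁ := ⟨_, rfl⟩
  have hc0 : 0 < c := by rw [hc]; positivity
  refine ⟨4 * (2 / c ^ 2 + k ^ 2 / c ^ 4), by positivity, fun L φ ψ hφ hψ N E hN hE => ?_⟩
  obtain ⟨M, hM0, hM, hME, hM8⟩ := hψ.exists_deriv_bound hN hE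
  have hE0 : 0 ≤ E := (sq_nonneg M).trans hME
  -- This `X` is chosen so that `X⁴ = M² E`, the quantity in the second difference bound. Since `M²
  -- ≤ E`, it also dominates `M`, so one number controls both `ψ_α` and the singular term.
  have hX4 : Real.sqrt (M * Real.sqrt E) ^ 4 = M ^ 2 * E := by
    have : Real.sqrt (M * Real.sqrt E) ^ 4 = (Real.sqrt (M * Real.sqrt E) ^ 2) ^ 2 := by ring
    rw [this, Real.sq_sqrt (by positivity), mul_pow, Real.sq_sqrt hE0]
  set X := Real.sqrt (M * Real.sqrt E)
  have hX0 : 0 ≤ X := Real.sqrt_nonneg _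
  have hMX : M ≤ X := by
    refine le_of_pow_le_pow_left₀ (n := 4) (by norm_num) hX0 ?_
    rw [hX4]
    calc M ^ 4 = M ^ 2 * M ^ 2 := by ring
      _ ≤ _ := by gcongr
  have hHol : ∀ a b, a ≤ b → b ≤ a + 1 → (deriv ψ b - deriv ψ a) ^ 2 ≤ (b - a) * E :=
    fun a b hab hb => hE ▸ hψ.sq_deriv_sub_le hab hb
  have key := singularTerm_eq_and_abs_le hm₁ hφ hψ.differentiable hc hk hX0 hM hHol hX4.ge hMX
  refine ⟨X, hX0, ?_, ?_, fun x => (hM x).trans hMX, ?_, fun x => (key x).2⟩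
  · refine le_of_pow_le_pow_left₀ (n := 2) (by norm_num) hE0 ?_
    calc (X ^ 2) ^ 2 = X ^ 4 := by ring
      _ = M ^ 2 * E := hX4
      _ ≤ E * E := by gcongr
      _ = E ^ 2 := by ring
  · calc X ^ 16 = (X ^ 4) ^ 4 := by ring
      _ = M ^ 8 * E ^ 4 := by rw [hX4]; ring
      _ ≤ (16 * (N * E ^ 3)) * E ^ 4 := by gcongr
      _ = _ := by ring
  · have e : singularTerm L φ ψ = fun α => ∫ h in (0 : ℝ)..(1 / 2), singularKernel L φ ψ α h :=
      funext fun α => (key α).1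
    rw [e]
    exact measurable_integral_singularKernel hφ.continuous hψ.continuous L

/-! ### The linearized operator as a second order form -/

/-- The factor of `η_α` in `weakIntegrand`. -/
noncomputable def fluxOne (L : ℝ) (φ ψ : ℝ → ℝ) (α : ℝ) : ℝ :=
  -(deriv ψ α / deriv φ α ^ 2) * deriv (potential L φ) α
    + potentialVariation L φ ψ α * (deriv (deriv φ) α / deriv φ α ^ 2)

/-- The factor of `η_αα` in `weakIntegrand`. -/
noncomputable def fluxTwo (L : ℝ) (φ ψ : ℝ → ℝ) (α : ℝ) : ℝ :=
  -(potentialVariation L φ ψ α / deriv φ α)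

section Flux

variable {m₁ m₂ L : ℝ} {φ ψ : ℝ → ℝ}

theorem weakIntegrand_eq (hm₁ : 0 < m₁) (hφ : IsProfile m₁ m₂ L φ) {η : ℝ → ℝ}
    (hη : Differentiable ℝ (deriv η)) (α : ℝ) :
    weakIntegrand L φ ψ η α
      = fluxOne L φ ψ α * deriv η α + fluxTwo L φ ψ α * deriv (deriv η) α := by
  have h0 := hφ.deriv_ne_zero hm₁ α
  have hd : deriv (fun y => deriv η y / deriv φ y) α
      = deriv (deriv η) α / deriv φ α - deriv η α * (deriv (deriv φ) α / deriv φ α ^ 2) := by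
    have := ((hη α).hasDerivAt.div (hφ.differentiable_deriv α).hasDerivAt h0).deriv
    rw [Pi.div_def] at this
    rw [this]
    field_simp
  rw [weakIntegrand, fluxOne, fluxTwo, hd]
  ring

/-- The zeroth and first order part of `potentialVariation`. -/
theorem exists_potentialVariation_bound (m₁ m₂ : ℝ) (hm₁ : 0 < m₁) (hm₂ : 0 < m₂) (s : ℝ)
    (hs : 0 ≤ s) :
    ∃ b, 0 ≤ b ∧ ∀ L φ ψ X α, IsProfile m₁ m₂ L φ → 0 ≤ X → |deriv ψ α| ≤ X →
      |singularTerm L φ ψ α| ≤ s * X →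
      |potentialVariation L φ ψ α
        + (1 / deriv φ α ^ 2 + 3 * (1 / deriv φ α ^ 4)) * deriv (deriv ψ) α| ≤ b * X := by
  refine ⟨2 * (m₂ / m₁ ^ 3) + 12 * (m₂ / m₁ ^ 5) + 2 * Real.pi ^ 2 / m₁ ^ 3 * s, by positivity,
    fun L φ ψ X α hφ hX hψ hS => ?_⟩
  have hL := hφ.le_period
  have hL0 : 0 < L := hm₁.trans_le hL
  have e : potentialVariation L φ ψ α
        + (1 / deriv φ α ^ 2 + 3 * (1 / deriv φ α ^ 4)) * deriv (deriv ψ) α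
      = (2 * (deriv (deriv φ) α / deriv φ α ^ 3) + 12 * (deriv (deriv φ) α / deriv φ α ^ 5))
        * deriv ψ α + -(2 * Real.pi ^ 2 / L ^ 3 * singularTerm L φ ψ α) := by
    rw [potentialVariation, singularTerm, iteratedDeriv_two, iteratedDeriv_two]
    ring
  have h3 := abs_div_pow_le 3 hm₁ (hφ.abs_second α) (hφ.neg_deriv_lower α)
  have h5 := abs_div_pow_le 5 hm₁ (hφ.abs_second α) (hφ.neg_deriv_lower α)
  rw [e]
  refine (abs_add_le _ _).trans ?_
  rw [add_mul _ (2 * Real.pi ^ 2 / m₁ ^ 3 * s)]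
  gcongr ?_ + ?_
  · rw [abs_mul]
    gcongr
    refine (abs_add_le _ _).trans ?_
    rw [abs_mul, abs_mul, abs_of_pos (by norm_num : (0 : ℝ) < 2),
      abs_of_pos (by norm_num : (0 : ℝ) < 12)]
    gcongr
  · rw [abs_neg, abs_mul, abs_of_nonneg (by positivity), mul_assoc (2 * Real.pi ^ 2 / m₁ ^ 3)]
    gcongr

/-- Pointwise estimates for the fluxes. -/
theorem exists_flux_bound (m₁ m₂ : ℝ) (hm₁ : 0 < m₁) (hm₂ : 0 < m₂) (s : ℝ) (hs : 0 ≤ s) :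
    ∃ g c, 0 < g ∧ 0 < c ∧ ∀ L φ ψ X α, IsProfile m₁ m₂ L φ → 0 ≤ X → |deriv ψ α| ≤ X →
      |singularTerm L φ ψ α| ≤ s * X →
      |fluxOne L φ ψ α| ≤ g * (|deriv (deriv ψ) α| + X) ∧
      |fluxTwo L φ ψ α| ≤ g * (|deriv (deriv ψ) α| + X) ∧
      fluxOne L φ ψ α * deriv ψ α + fluxTwo L φ ψ α * deriv (deriv ψ) α
        ≤ -c * deriv (deriv ψ) α ^ 2 + g * (|deriv (deriv ψ) α| + X) * X := by
  obtain ⟨b, hb0, hb⟩ := exists_potentialVariation_bound m₁ m₂ hm₁ hm₂ s hs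
  obtain ⟨A, hA⟩ := exists_abs_deriv_potential_le m₁ m₂ hm₁
  have hA' : ∀ L φ, IsProfile m₁ m₂ L φ → ∀ α, |deriv (potential L φ) α| ≤ |A| :=
    fun L φ hφ α => (hA L φ hφ α).trans (le_abs_self A)
  set p := 1 / m₁ ^ 2 + 3 * (1 / m₁ ^ 4) with hp
  have hp0 : 0 < p := by positivity
  set g₁ := |A| / m₁ ^ 2 + (p + b) * (m₂ / m₁ ^ 2) with hg₁
  have hg₁0 : 0 < g₁ := by positivity
  set g₂ := (p + b) / m₁ with hg₂
  have hg₂0 : 0 < g₂ := by positivity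
  refine ⟨g₁ + g₂, 1 / m₂ ^ 3, by positivity, by positivity,
    fun L φ ψ X α hφ hX hψ hS => ?_⟩
  have hB := hb L φ ψ X α hφ hX hψ hS
  have hd := hφ.neg_deriv_lower α
  have hd0 := hφ.deriv_ne_zero hm₁ α
  have hpot := hA' L φ hφ α
  set B := potentialVariation L φ ψ α with hBdef
  set P := 1 / deriv φ α ^ 2 + 3 * (1 / deriv φ α ^ 4) with hP
  set z := deriv (deriv ψ) α
  set y := deriv ψ α
  set d := deriv φ α
  have hPle : |P| ≤ p := by
    rw [hp]
    refine (abs_add_le _ _).trans ?_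
    rw [abs_mul, abs_of_pos (by norm_num : (0 : ℝ) < 3)]
    gcongr
    · exact abs_div_pow_le 2 hm₁ (abs_one).le hd
    · exact abs_div_pow_le 4 hm₁ (abs_one).le hd
  have hBle : |B| ≤ (p + b) * (|z| + X) := by
    have e : B = (B + P * z) - P * z := by ring
    rw [e]
    refine (abs_sub _ _).trans ?_
    rw [abs_mul P z]
    nlinarith [mul_le_mul_of_nonneg_right hPle (abs_nonneg z), mul_nonneg hp0.le hX,
      mul_nonneg hb0 (abs_nonneg z)]
  have hw := abs_div_pow_le 2 hm₁ (hφ.abs_second α) hd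
  have hzX : X ≤ |z| + X := le_add_of_nonneg_left (abs_nonneg z)
  have h1 : |fluxOne L φ ψ α| ≤ g₁ * (|z| + X) := by
    rw [fluxOne]
    refine (abs_add_le _ _).trans ?_
    rw [abs_mul, abs_mul, abs_neg, hg₁, add_mul]
    gcongr ?_ + ?_
    · calc |y / d ^ 2| * |deriv (potential L φ) α| ≤ (X / m₁ ^ 2) * |A| := by
            gcongr
            exact abs_div_pow_le 2 hm₁ hψ hd
        _ = |A| / m₁ ^ 2 * X := by ring
        _ ≤ _ := by gcongr
    · calc |B| * |deriv (deriv φ) α / d ^ 2| ≤ ((p + b) * (|z| + X)) * (m₂ / m₁ ^ 2) := by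
            gcongr
        _ = _ := by ring
  have h2 : |fluxTwo L φ ψ α| ≤ g₂ * (|z| + X) := by
    rw [fluxTwo, abs_neg, abs_div]
    calc |B| / |d| ≤ ((p + b) * (|z| + X)) / m₁ := by gcongr
      _ = _ := by ring
  refine ⟨h1.trans ?_, h2.trans ?_, ?_⟩
  · gcongr; linarith
  · gcongr; linarith
  -- Coercivity: `1/φ_α²` contributes `1/m₂²`, the `1/φ_α⁴` term is dropped as nonnegative, and
  -- dividing by `-φ_α ∈ (0, m₂]` costs one more power of `m₂`.
  · have hlead : 1 / m₂ ^ 3 ≤ P / (-d) := by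
      have hdneg : 0 < -d := by linarith [hφ.deriv_le α]
      have hdle : -d ≤ m₂ := by linarith [hφ.le_deriv α]
      have hP' : 1 / m₂ ^ 2 ≤ P := by
        have h4 : 0 ≤ 3 * (1 / d ^ 4) := by positivity
        have : 1 / m₂ ^ 2 ≤ 1 / d ^ 2 := by
          apply one_div_le_one_div_of_le (by positivity)
          rw [← neg_sq d]
          exact pow_le_pow_left₀ hdneg.le hdle 2
        linarith
      calc 1 / m₂ ^ 3 = 1 / m₂ ^ 2 / m₂ := by field_simp
        _ ≤ P / (-d) := div_le_div₀ (le_trans (by positivity) hP') hP' hdneg hdle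
    have e : fluxTwo L φ ψ α * z = -(P / (-d)) * z ^ 2 + -((B + P * z) / d * z) := by
      rw [show fluxTwo L φ ψ α = -(B / d) from rfl]
      field_simp
      ring
    have h3 : -((B + P * z) / d * z) ≤ b / m₁ * X * |z| := by
      refine (neg_le_abs _).trans ?_
      rw [abs_mul, abs_div]
      gcongr
      calc |B + P * z| / |d| ≤ b * X / m₁ := by gcongr
        _ = _ := by ring
    have h4 : fluxOne L φ ψ α * y ≤ g₁ * (|z| + X) * X := by
      refine (le_abs_self _).trans ?_
      rw [abs_mul]
      gcongr
    have h5 : b / m₁ * X * |z| ≤ g₂ * (|z| + X) * X := by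
      have : b / m₁ ≤ g₂ := by rw [hg₂]; gcongr; linarith
      calc b / m₁ * X * |z| ≤ g₂ * X * (|z| + X) := by gcongr; linarith
        _ = _ := by ring
    rw [e]
    have h6 := mul_le_mul_of_nonneg_right hlead (sq_nonneg z)
    linarith

theorem measurable_potentialVariation (hS : Measurable (singularTerm L φ ψ)) :
    Measurable (potentialVariation L φ ψ) := by
  have e : potentialVariation L φ ψ = fun α =>
      (-(1 / deriv φ α ^ 2) - 3 * (1 / deriv φ α ^ 4)) * deriv (deriv ψ) α
        + (2 * deriv (deriv φ) α / deriv φ α ^ 3 + 12 * deriv (deriv φ) α / deriv φ α ^ 5)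
          * deriv ψ α - 2 * Real.pi ^ 2 / L ^ 3 * singularTerm L φ ψ α := by
    funext α
    rw [potentialVariation, singularTerm, iteratedDeriv_two, iteratedDeriv_two]
  have h1 := measurable_deriv φ
  have h2 := measurable_deriv (deriv φ)
  have h3 := measurable_deriv ψ
  have h4 := measurable_deriv (deriv ψ)
  rw [e]
  fun_prop

theorem measurable_fluxOne (hS : Measurable (singularTerm L φ ψ)) :
    Measurable (fluxOne L φ ψ) := by
  have h1 := measurable_deriv φ
  have h2 := measurable_deriv (deriv φ)
  have h3 := measurable_deriv ψ
  have h4 := measurable_deriv (potential L φ)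
  have h5 := measurable_potentialVariation hS
  unfold fluxOne
  fun_prop

theorem measurable_fluxTwo (hS : Measurable (singularTerm L φ ψ)) :
    Measurable (fluxTwo L φ ψ) := by
  have h1 := measurable_deriv φ
  have h5 := measurable_potentialVariation hS
  unfold fluxTwo
  fun_prop

/-- Young's inequality without fractional powers: unless `c E` already absorbs `G X²`, one has `E <
(G/c) X²`. Inserting this into the hypothesis and cancelling `X¹⁴` bounds `X²` by a multiple of `N`.
-/
theorem interpolation_le {G c N E X : ℝ} (hG : 0 < G) (hc : 0 < c) (hN : 0 ≤ N) (hE : 0 ≤ E)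
    (hX : X ^ 16 ≤ 16 * (N * E ^ 7)) :
    -c * E + G * X ^ 2 ≤ G * (16 * (G / c) ^ 7) * N := by
  have hR : 0 ≤ G * (16 * (G / c) ^ 7) * N := by positivity
  rcases le_or_gt (G * X ^ 2) (c * E) with h | h
  · linarith
  · have hX2 : 0 < X ^ 2 := by
      by_contra hcon
      have : X ^ 2 = 0 := le_antisymm (not_lt.1 hcon) (sq_nonneg X)
      rw [this] at h
      nlinarith [mul_nonneg hc.le hE]
    have hEle : E ≤ G / c * X ^ 2 := by
      rw [div_mul_eq_mul_div, le_div_iff₀ hc]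
      linarith
    have h1 : X ^ 2 * (X ^ 2) ^ 7 ≤ 16 * (G / c) ^ 7 * N * (X ^ 2) ^ 7 := by
      calc X ^ 2 * (X ^ 2) ^ 7 = X ^ 16 := by ring
        _ ≤ 16 * (N * E ^ 7) := hX
        _ ≤ 16 * (N * (G / c * X ^ 2) ^ 7) := by gcongr
        _ = _ := by ring
    have h2 := le_of_mul_le_mul_right h1 (by positivity)
    calc -c * E + G * X ^ 2 ≤ G * X ^ 2 := by nlinarith [mul_nonneg hc.le hE]
      _ ≤ G * (16 * (G / c) ^ 7 * N) := by gcongr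
      _ = _ := by ring

end Flux

/-- The energy estimate at fixed time. -/
theorem exists_energy_bound (m₁ m₂ : ℝ) (hm₁ : 0 < m₁) (hm₂ : 0 < m₂) :
    ∃ K, 0 ≤ K ∧ ∀ L φ ψ, IsProfile m₁ m₂ L φ → MemH2Per ψ →
      ∀ N E, N = ∫ x, ψ x ^ 2 ∂unitMeasure → E = ∫ x, deriv (deriv ψ) x ^ 2 ∂unitMeasure →
      MemLp (fluxOne L φ ψ) 2 unitMeasure ∧ MemLp (fluxTwo L φ ψ) 2 unitMeasure ∧
      ∫ x, fluxOne L φ ψ x ^ 2 ∂unitMeasure ≤ K * E ∧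
      ∫ x, fluxTwo L φ ψ x ^ 2 ∂unitMeasure ≤ K * E ∧
      ∫ x, deriv ψ x ^ 2 ∂unitMeasure ≤ E ∧
      ∫ x, (fluxOne L φ ψ x * deriv ψ x + fluxTwo L φ ψ x * deriv (deriv ψ) x) ∂unitMeasure
        ≤ K * N := by
  obtain ⟨s, hs0, hs⟩ := exists_singularTerm_bound m₁ m₂ hm₁ hm₂
  obtain ⟨g, c, hg, hc, hflux⟩ := exists_flux_bound m₁ m₂ hm₁ hm₂ s hs0
  -- Young's inequality turns `g |ψ_αα| X` into half of the dissipation plus `g² X² / (2c)`; the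
  -- summand `g` comes from the term `g X²`. Hence `c / 2` in the next constant.
  set G := g ^ 2 / (2 * c) + g with hGdef
  have hG : 0 < G := by positivity
  set K₁ := G * (16 * (G / (c / 2)) ^ 7) with hK₁
  have hK₁0 : 0 ≤ K₁ := by positivity
  refine ⟨4 * g ^ 2 + K₁, by positivity, fun L φ ψ hφ hψ N E hN hE => ?_⟩
  have hN' : N = ∫ x in (0 : ℝ)..1, ψ x ^ 2 := by rw [hN, intervalIntegral_eq_unit]
  have hE' : E = ∫ x in (0 : ℝ)..1, deriv (deriv ψ) x ^ 2 := by rw [hE, intervalIntegral_eq_unit]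
  obtain ⟨X, hX0, hXE, hX16, hX, hSm, hS⟩ := hs L φ ψ hφ hψ N E hN' hE'
  have hb := fun α => hflux L φ ψ X α hφ hX0 (hX α) (hS α)
  have hN0 : 0 ≤ N := hN ▸ integral_nonneg fun _ => sq_nonneg _
  have hE0 : 0 ≤ E := hE ▸ integral_nonneg fun _ => sq_nonneg _
  have hz := hψ.memLp_deriv_deriv
  have hzi := hz.integrable_sq
  have hdom : MemLp (fun x => g * (|deriv (deriv ψ) x| + X)) 2 unitMeasure :=
    (hz.abs.add (memLp_const X)).const_mul g
  have m1 : MemLp (fluxOne L φ ψ) 2 unitMeasure :=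
    hdom.mono' (measurable_fluxOne hSm).aestronglyMeasurable (ae_of_all _ fun x => (hb x).1)
  have m2 : MemLp (fluxTwo L φ ψ) 2 unitMeasure :=
    hdom.mono' (measurable_fluxTwo hSm).aestronglyMeasurable (ae_of_all _ fun x => (hb x).2.1)
  have hsq : ∀ f : ℝ → ℝ, MemLp f 2 unitMeasure →
      (∀ x, |f x| ≤ g * (|deriv (deriv ψ) x| + X)) →
      ∫ x, f x ^ 2 ∂unitMeasure ≤ (4 * g ^ 2 + K₁) * E := by
    intro f hf hfb
    have h1 : ∫ x, f x ^ 2 ∂unitMeasure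
        ≤ ∫ x, (2 * g ^ 2 * deriv (deriv ψ) x ^ 2 + 2 * g ^ 2 * X ^ 2) ∂unitMeasure := by
      refine integral_mono hf.integrable_sq ((hzi.const_mul _).add (integrable_const _)) fun x => ?_
      have := pow_le_pow_left₀ (abs_nonneg _) (hfb x) 2
      rw [sq_abs] at this
      refine this.trans ?_
      rw [mul_pow, ← sq_abs (deriv (deriv ψ) x)]
      nlinarith [mul_nonneg (sq_nonneg g) (sq_nonneg (|deriv (deriv ψ) x| - X))]
    rw [integral_add (hzi.const_mul _) (integrable_const _), integral_const_mul, ← hE] at h1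
    simp only [integral_const, probReal_univ, one_smul] at h1
    nlinarith [mul_le_mul_of_nonneg_left hXE (by positivity : 0 ≤ 2 * g ^ 2),
      mul_nonneg hK₁0 hE0]
  have hderiv : MemLp (deriv ψ) 2 unitMeasure := by
    rw [unitMeasure_eq]
    exact memLp_two_restrict_Ioc hψ.continuous_deriv.continuousOn
  refine ⟨m1, m2, hsq _ m1 fun x => (hb x).1, hsq _ m2 fun x => (hb x).2.1, ?_, ?_⟩
  · calc ∫ x, deriv ψ x ^ 2 ∂unitMeasure ≤ ∫ _, X ^ 2 ∂unitMeasure := by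
          refine integral_mono hderiv.integrable_sq (integrable_const _) fun x => ?_
          rw [← sq_abs]
          exact pow_le_pow_left₀ (abs_nonneg _) (hX x) 2
      _ = X ^ 2 := by simp
      _ ≤ E := hXE
  · have h1 : ∫ x, (fluxOne L φ ψ x * deriv ψ x + fluxTwo L φ ψ x * deriv (deriv ψ) x) ∂unitMeasure
        ≤ ∫ x, (-(c / 2) * deriv (deriv ψ) x ^ 2 + G * X ^ 2) ∂unitMeasure := by
      refine integral_mono ((m1.integrable_mul hderiv).add (m2.integrable_mul hz))
        ((hzi.const_mul _).add (integrable_const _)) fun x => (hb x).2.2.trans ?_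
      have hyoung : g * |deriv (deriv ψ) x| * X
          ≤ c / 2 * |deriv (deriv ψ) x| ^ 2 + g ^ 2 / (2 * c) * X ^ 2 := by
        have h := sq_nonneg (c * |deriv (deriv ψ) x| - g * X)
        have e : c / 2 * |deriv (deriv ψ) x| ^ 2 + g ^ 2 / (2 * c) * X ^ 2
            - g * |deriv (deriv ψ) x| * X
            = (c * |deriv (deriv ψ) x| - g * X) ^ 2 / (2 * c) := by
          field_simp
          ring
        have := div_nonneg h (by positivity : 0 ≤ 2 * c)
        linarith
      rw [sq_abs] at hyoung
      rw [hGdef]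
      nlinarith
    rw [integral_add (hzi.const_mul _) (integrable_const _), integral_const_mul, ← hE] at h1
    simp only [integral_const, probReal_univ, one_smul] at h1
    refine (h1.trans (interpolation_le hG (by positivity) hN0 hE0 hX16)).trans ?_
    gcongr
    nlinarith [sq_nonneg g]

/-! ### Real Fourier coefficients on one period -/

/-- The trigonometric function `cos (2πkx)`. -/
noncomputable def cosWave (k : ℤ) (x : ℝ) : ℝ := Real.cos (2 * Real.pi * k * x)

/-- The trigonometric function `sin (2πkx)`. -/
noncomputable def sinWave (k : ℤ) (x : ℝ) : ℝ := Real.sin (2 * Real.pi * k * x)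

/-- The cosine coefficient of `f` over one period. -/
noncomputable def cosCoeff (f : ℝ → ℝ) (k : ℤ) : ℝ := ∫ x, f x * cosWave k x ∂unitMeasure

/-- The sine coefficient of `f` over one period. -/
noncomputable def sinCoeff (f : ℝ → ℝ) (k : ℤ) : ℝ := ∫ x, f x * sinWave k x ∂unitMeasure

theorem contDiff_cosWave (k : ℤ) {n : WithTop ℕ∞} : ContDiff ℝ n (cosWave k) := by
  unfold cosWave; fun_prop

theorem contDiff_sinWave (k : ℤ) {n : WithTop ℕ∞} : ContDiff ℝ n (sinWave k) := by
  unfold sinWave; fun_prop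

theorem periodic_cosWave (k : ℤ) : Function.Periodic (cosWave k) 1 := by
  intro x
  rw [cosWave, cosWave, ← Real.cos_add_int_mul_two_pi (2 * Real.pi * k * x) k]
  congr 1; ring

theorem periodic_sinWave (k : ℤ) : Function.Periodic (sinWave k) 1 := by
  intro x
  rw [sinWave, sinWave, ← Real.sin_add_int_mul_two_pi (2 * Real.pi * k * x) k]
  congr 1; ring

theorem deriv_cosWave (k : ℤ) : deriv (cosWave k) = fun x => -(2 * Real.pi * k) * sinWave k x := by
  funext x
  have := ((hasDerivAt_id x).const_mul (2 * Real.pi * k)).cos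
  refine (this.congr_deriv ?_).deriv
  simp [sinWave]; ring

theorem deriv_sinWave (k : ℤ) : deriv (sinWave k) = fun x => (2 * Real.pi * k) * cosWave k x := by
  funext x
  have := ((hasDerivAt_id x).const_mul (2 * Real.pi * k)).sin
  refine (this.congr_deriv ?_).deriv
  simp [cosWave]; ring

theorem deriv_deriv_cosWave (k : ℤ) :
    deriv (deriv (cosWave k)) = fun x => -(2 * Real.pi * k) ^ 2 * cosWave k x := by
  rw [deriv_cosWave]
  funext x
  rw [deriv_const_mul_field, deriv_sinWave]
  ring

theorem deriv_deriv_sinWave (k : ℤ) :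
    deriv (deriv (sinWave k)) = fun x => -(2 * Real.pi * k) ^ 2 * sinWave k x := by
  rw [deriv_sinWave]
  funext x
  rw [deriv_const_mul_field, deriv_cosWave]
  ring

theorem memLp_unit_of_continuous {f : ℝ → ℝ} (hf : Continuous f) : MemLp f 2 unitMeasure := by
  rw [unitMeasure_eq]
  exact memLp_two_restrict_Ioc hf.continuousOn

theorem integrable_mul_cosWave {f : ℝ → ℝ} (hf : MemLp f 2 unitMeasure) (k : ℤ) :
    Integrable (fun x => f x * cosWave k x) unitMeasure :=
  hf.integrable_mul (memLp_unit_of_continuous (contDiff_cosWave k (n := 0)).continuous)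

theorem integrable_mul_sinWave {f : ℝ → ℝ} (hf : MemLp f 2 unitMeasure) (k : ℤ) :
    Integrable (fun x => f x * sinWave k x) unitMeasure :=
  hf.integrable_mul (memLp_unit_of_continuous (contDiff_sinWave k (n := 0)).continuous)

theorem fourierCoeffOn_ofReal {f : ℝ → ℝ} (hf : MemLp f 2 unitMeasure) (k : ℤ) :
    fourierCoeffOn (zero_lt_one' ℝ) (fun x => (f x : ℂ)) k
      = (cosCoeff f k : ℂ) - Complex.I * (sinCoeff f k : ℂ) := by
  rw [fourierCoeffOn_eq_integral, sub_zero, div_one, one_smul,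
    intervalIntegral.integral_of_le zero_le_one, ← unitMeasure_eq]
  have e : ∀ x : ℝ, (fourier (-k) (x : AddCircle (1 : ℝ)) : ℂ) • (f x : ℂ)
      = ((f x * cosWave k x : ℝ) : ℂ) - Complex.I * ((f x * sinWave k x : ℝ) : ℂ) := by
    intro x
    rw [fourier_coe_apply, cosWave, sinWave]
    have : (2 * Real.pi * Complex.I * ((-k : ℤ) : ℂ) * x / (1 : ℝ) : ℂ)
        = ((-(2 * Real.pi * k * x) : ℝ) : ℂ) * Complex.I := by
      push_cast; ring
    rw [this, Complex.exp_mul_I, ← Complex.ofReal_cos, ← Complex.ofReal_sin, Real.cos_neg,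
      Real.sin_neg, smul_eq_mul]
    push_cast
    ring
  simp only [e]
  have hc : Integrable (fun x => ((f x * cosWave k x : ℝ) : ℂ)) unitMeasure :=
    (integrable_mul_cosWave hf k).ofReal
  have hs : Integrable (fun x => ((f x * sinWave k x : ℝ) : ℂ)) unitMeasure :=
    (integrable_mul_sinWave hf k).ofReal
  have hs' : Integrable (fun x => Complex.I * ((f x * sinWave k x : ℝ) : ℂ)) unitMeasure :=
    hs.const_mul Complex.I
  rw [integral_sub hc hs', integral_const_mul]
  congr 1
  · exact integral_ofReal
  · exact congrArg _ integral_ofReal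

/-- For real `f` the squared modulus of the complex Fourier coefficient is the sum of the two
squares. Summing over all of `ℤ` counts each nonzero frequency twice, so no factor `2` appears. -/
theorem hasSum_sq_coeff {f : ℝ → ℝ} (hf : MemLp f 2 unitMeasure) :
    HasSum (fun k : ℤ => cosCoeff f k ^ 2 + sinCoeff f k ^ 2) (∫ x, f x ^ 2 ∂unitMeasure) := by
  have hf' : MemLp (fun x => (f x : ℂ)) 2 (volume.restrict (Ioc (0 : ℝ) 1)) := by
    rw [← unitMeasure_eq]; exact hf.ofReal
  have h := hasSum_sq_fourierCoeffOn zero_lt_one hf'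
  rw [sub_zero, inv_one, one_smul, intervalIntegral_eq_unit] at h
  convert h using 1
  · funext k
    rw [fourierCoeffOn_ofReal hf, ← Complex.normSq_eq_norm_sq, Complex.normSq_apply]
    simp
    ring
  · simp

theorem cosCoeff_add {f g : ℝ → ℝ} (hf : MemLp f 2 unitMeasure) (hg : MemLp g 2 unitMeasure)
    (k : ℤ) : cosCoeff (f + g) k = cosCoeff f k + cosCoeff g k := by
  simp only [cosCoeff, Pi.add_apply, add_mul]
  exact integral_add (integrable_mul_cosWave hf k) (integrable_mul_cosWave hg k)

theorem sinCoeff_add {f g : ℝ → ℝ} (hf : MemLp f 2 unitMeasure) (hg : MemLp g 2 unitMeasure)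
    (k : ℤ) : sinCoeff (f + g) k = sinCoeff f k + sinCoeff g k := by
  simp only [sinCoeff, Pi.add_apply, add_mul]
  exact integral_add (integrable_mul_sinWave hf k) (integrable_mul_sinWave hg k)

/-- Parseval's identity for the product of two square integrable functions. -/
theorem hasSum_mul_coeff {f g : ℝ → ℝ} (hf : MemLp f 2 unitMeasure) (hg : MemLp g 2 unitMeasure) :
    HasSum (fun k : ℤ => cosCoeff f k * cosCoeff g k + sinCoeff f k * sinCoeff g k)
      (∫ x, f x * g x ∂unitMeasure) := by
  -- Polarization of Parseval's identity.
  have h := (((hasSum_sq_coeff (hf.add hg)).sub (hasSum_sq_coeff hf)).sub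
    (hasSum_sq_coeff hg)).div_const 2
  have hfg : Integrable (fun x => f x * g x) unitMeasure := hf.integrable_mul hg
  have e : ∫ x, (f + g) x ^ 2 ∂unitMeasure
      = (∫ x, f x ^ 2 ∂unitMeasure) + ((∫ x, g x ^ 2 ∂unitMeasure)
        + 2 * ∫ x, f x * g x ∂unitMeasure) := by
    have h2 : Integrable (fun x => g x ^ 2 + 2 * (f x * g x)) unitMeasure :=
      hg.integrable_sq.add (hfg.const_mul 2)
    rw [← integral_const_mul, ← integral_add hg.integrable_sq (hfg.const_mul 2),
      ← integral_add hf.integrable_sq h2]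
    congr 1; funext x
    simp only [Pi.add_apply]
    ring
  have e1 : (fun k : ℤ => cosCoeff f k * cosCoeff g k + sinCoeff f k * sinCoeff g k)
      = fun k => (cosCoeff (f + g) k ^ 2 + sinCoeff (f + g) k ^ 2
        - (cosCoeff f k ^ 2 + sinCoeff f k ^ 2) - (cosCoeff g k ^ 2 + sinCoeff g k ^ 2)) / 2 := by
    funext k
    rw [cosCoeff_add hf hg, sinCoeff_add hf hg]
    ring
  have e2 : ∫ x, f x * g x ∂unitMeasure = ((∫ x, (f + g) x ^ 2 ∂unitMeasure)
      - (∫ x, f x ^ 2 ∂unitMeasure) - ∫ x, g x ^ 2 ∂unitMeasure) / 2 := by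
    rw [e]
    ring
  rw [e1, e2]
  exact h

/-- Uniform in the finite set `s`, as needed to dominate the partial sums of modes in time. -/
theorem abs_sum_mul_coeff_le {f g : ℝ → ℝ} (hf : MemLp f 2 unitMeasure)
    (hg : MemLp g 2 unitMeasure) (s : Finset ℤ) :
    |∑ k ∈ s, (cosCoeff f k * cosCoeff g k + sinCoeff f k * sinCoeff g k)|
      ≤ (∫ x, f x ^ 2 ∂unitMeasure) + ∫ x, g x ^ 2 ∂unitMeasure := by
  have h1 := sum_le_hasSum s (fun k _ => by positivity) (hasSum_sq_coeff hf)
  have h2 := sum_le_hasSum s (fun k _ => by positivity) (hasSum_sq_coeff hg)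
  refine (Finset.abs_sum_le_sum_abs _ _).trans ((Finset.sum_le_sum fun k _ => ?_).trans
    ((Finset.sum_add_distrib).le.trans (add_le_add h1 h2)))
  rw [abs_le]
  constructor <;>
  nlinarith [sq_nonneg (cosCoeff f k + cosCoeff g k), sq_nonneg (cosCoeff f k - cosCoeff g k),
    sq_nonneg (sinCoeff f k + sinCoeff g k), sq_nonneg (sinCoeff f k - sinCoeff g k)]

theorem cosCoeff_deriv {f : ℝ → ℝ} (hf : AbsolutelyContinuousOnInterval f 0 1)
    (h01 : f 1 = f 0) (k : ℤ) : cosCoeff (deriv f) k = 2 * Real.pi * k * sinCoeff f k := by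
  have hw : AbsolutelyContinuousOnInterval (cosWave k) 0 1 :=
    (contDiff_cosWave k (n := 1)).contDiffOn.absolutelyContinuousOnInterval
  have h := hf.integral_mul_deriv_eq_deriv_mul hw
  have e1 : cosWave k 1 = cosWave k 0 := by simpa using periodic_cosWave k 0
  rw [h01, e1, sub_self, zero_sub, deriv_cosWave, intervalIntegral_eq_unit,
    intervalIntegral_eq_unit] at h
  rw [cosCoeff, sinCoeff, ← integral_const_mul]
  rw [← neg_eq_iff_eq_neg, ← integral_neg] at h
  rw [← h]
  congr 1; funext x; ring

theorem sinCoeff_deriv {f : ℝ → ℝ} (hf : AbsolutelyContinuousOnInterval f 0 1)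
    (h01 : f 1 = f 0) (k : ℤ) : sinCoeff (deriv f) k = -(2 * Real.pi * k) * cosCoeff f k := by
  have hw : AbsolutelyContinuousOnInterval (sinWave k) 0 1 :=
    (contDiff_sinWave k (n := 1)).contDiffOn.absolutelyContinuousOnInterval
  have h := hf.integral_mul_deriv_eq_deriv_mul hw
  have e1 : sinWave k 1 = sinWave k 0 := by simpa using periodic_sinWave k 0
  rw [h01, e1, sub_self, zero_sub, deriv_sinWave, intervalIntegral_eq_unit,
    intervalIntegral_eq_unit] at h
  rw [cosCoeff, sinCoeff, ← integral_const_mul]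
  rw [← neg_eq_iff_eq_neg, ← integral_neg] at h
  rw [← h]
  congr 1; funext x; ring

/-! ### The weak form tested with Fourier modes -/

section WeakForm

variable {m₁ m₂ L : ℝ} {φ ψ : ℝ → ℝ}

theorem integral_weakIntegrand_cosWave (hm₁ : 0 < m₁) (hφ : IsProfile m₁ m₂ L φ)
    (h₁ : MemLp (fluxOne L φ ψ) 2 unitMeasure) (h₂ : MemLp (fluxTwo L φ ψ) 2 unitMeasure) (k : ℤ) :
    ∫ x in (0 : ℝ)..1, weakIntegrand L φ ψ (cosWave k) x
      = -(2 * Real.pi * k) * sinCoeff (fluxOne L φ ψ) k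
        + -(2 * Real.pi * k) ^ 2 * cosCoeff (fluxTwo L φ ψ) k := by
  have hd : Differentiable ℝ (deriv (cosWave k)) := by
    rw [deriv_cosWave]
    exact ((contDiff_sinWave k (n := 1)).differentiable (by norm_num)).const_mul _
  rw [intervalIntegral_eq_unit, sinCoeff, cosCoeff, ← integral_const_mul, ← integral_const_mul,
    ← integral_add ((integrable_mul_sinWave h₁ k).const_mul _)
      ((integrable_mul_cosWave h₂ k).const_mul _)]
  congr 1; funext x
  rw [weakIntegrand_eq hm₁ hφ hd, deriv_deriv_cosWave, deriv_cosWave]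
  ring

theorem integral_weakIntegrand_sinWave (hm₁ : 0 < m₁) (hφ : IsProfile m₁ m₂ L φ)
    (h₁ : MemLp (fluxOne L φ ψ) 2 unitMeasure) (h₂ : MemLp (fluxTwo L φ ψ) 2 unitMeasure) (k : ℤ) :
    ∫ x in (0 : ℝ)..1, weakIntegrand L φ ψ (sinWave k) x
      = (2 * Real.pi * k) * cosCoeff (fluxOne L φ ψ) k
        + -(2 * Real.pi * k) ^ 2 * sinCoeff (fluxTwo L φ ψ) k := by
  have hd : Differentiable ℝ (deriv (sinWave k)) := by
    rw [deriv_sinWave]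
    exact ((contDiff_cosWave k (n := 1)).differentiable (by norm_num)).const_mul _
  rw [intervalIntegral_eq_unit, sinCoeff, cosCoeff, ← integral_const_mul, ← integral_const_mul,
    ← integral_add ((integrable_mul_cosWave h₁ k).const_mul _)
      ((integrable_mul_sinWave h₂ k).const_mul _)]
  congr 1; funext x
  rw [weakIntegrand_eq hm₁ hφ hd, deriv_deriv_sinWave, deriv_sinWave]
  ring

/-- The weak form tested with the `k`-th Fourier mode of `ψ`. -/
noncomputable def modePairing (L : ℝ) (φ ψ : ℝ → ℝ) (k : ℤ) : ℝ :=
  cosCoeff ψ k * (∫ x in (0 : ℝ)..1, weakIntegrand L φ ψ (cosWave k) x)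
    + sinCoeff ψ k * ∫ x in (0 : ℝ)..1, weakIntegrand L φ ψ (sinWave k) x

/-- The factors `2πk` and `(2πk)²` produced by differentiating the test wave are moved onto the
coefficients of `ψ`, where they become the coefficients of `ψ_α` and `ψ_αα`. The sum over `k` is
then a Parseval sum of `L²` functions. -/
theorem modePairing_eq (hm₁ : 0 < m₁) (hφ : IsProfile m₁ m₂ L φ) (hψ : MemH2Per ψ)
    (h₁ : MemLp (fluxOne L φ ψ) 2 unitMeasure) (h₂ : MemLp (fluxTwo L φ ψ) 2 unitMeasure) (k : ℤ) :
    modePairing L φ ψ k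
      = (cosCoeff (fluxOne L φ ψ) k * cosCoeff (deriv ψ) k
          + sinCoeff (fluxOne L φ ψ) k * sinCoeff (deriv ψ) k)
        + (cosCoeff (fluxTwo L φ ψ) k * cosCoeff (deriv (deriv ψ)) k
          + sinCoeff (fluxTwo L φ ψ) k * sinCoeff (deriv (deriv ψ)) k) := by
  have hac : AbsolutelyContinuousOnInterval ψ 0 1 :=
    hψ.2.1.contDiffOn.absolutelyContinuousOnInterval
  have e0 : deriv ψ 1 = deriv ψ 0 := by simpa using periodic_deriv hψ.1 0
  have e1 : ψ 1 = ψ 0 := by simpa using hψ.1 0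
  rw [modePairing, integral_weakIntegrand_cosWave hm₁ hφ h₁ h₂,
    integral_weakIntegrand_sinWave hm₁ hφ h₁ h₂, cosCoeff_deriv (hψ.2.2.1 0 1) e0,
    sinCoeff_deriv (hψ.2.2.1 0 1) e0, cosCoeff_deriv hac e1, sinCoeff_deriv hac e1]
  ring

theorem hasSum_modePairing (hm₁ : 0 < m₁) (hφ : IsProfile m₁ m₂ L φ) (hψ : MemH2Per ψ)
    (h₁ : MemLp (fluxOne L φ ψ) 2 unitMeasure) (h₂ : MemLp (fluxTwo L φ ψ) 2 unitMeasure) :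
    HasSum (modePairing L φ ψ) (∫ x, (fluxOne L φ ψ x * deriv ψ x
      + fluxTwo L φ ψ x * deriv (deriv ψ) x) ∂unitMeasure) := by
  have hd := memLp_unit_of_continuous hψ.continuous_deriv
  have hdd := hψ.memLp_deriv_deriv
  have h := (hasSum_mul_coeff h₁ hd).add (hasSum_mul_coeff h₂ hdd)
  have i₁ : Integrable (fun x => fluxOne L φ ψ x * deriv ψ x) unitMeasure := h₁.integrable_mul hd
  have i₂ : Integrable (fun x => fluxTwo L φ ψ x * deriv (deriv ψ) x) unitMeasure :=
    h₂.integrable_mul hdd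
  rw [← integral_add i₁ i₂] at h
  rwa [funext (modePairing_eq hm₁ hφ hψ h₁ h₂)]

theorem abs_sum_modePairing_le (hm₁ : 0 < m₁) (hφ : IsProfile m₁ m₂ L φ) (hψ : MemH2Per ψ)
    (h₁ : MemLp (fluxOne L φ ψ) 2 unitMeasure) (h₂ : MemLp (fluxTwo L φ ψ) 2 unitMeasure)
    (s : Finset ℤ) :
    |∑ k ∈ s, modePairing L φ ψ k|
      ≤ ((∫ x, fluxOne L φ ψ x ^ 2 ∂unitMeasure) + ∫ x, deriv ψ x ^ 2 ∂unitMeasure)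
        + ((∫ x, fluxTwo L φ ψ x ^ 2 ∂unitMeasure)
          + ∫ x, deriv (deriv ψ) x ^ 2 ∂unitMeasure) := by
  simp only [modePairing_eq hm₁ hφ hψ h₁ h₂, Finset.sum_add_distrib]
  simp only [← Finset.sum_add_distrib]
  rw [Finset.sum_add_distrib]
  exact (abs_add_le _ _).trans (add_le_add
    (abs_sum_mul_coeff_le h₁ (memLp_unit_of_continuous hψ.continuous_deriv) s)
    (abs_sum_mul_coeff_le h₂ hψ.memLp_deriv_deriv s))

end WeakForm

/-! ### Evolution in time -/

/-- The energy identity for a primitive. -/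
theorem sq_sub_sq_eq_integral {u f : ℝ → ℝ} {T : ℝ} (hf : IntervalIntegrable f volume 0 T)
    (hu : ∀ t ∈ Icc 0 T, u t - u 0 = ∫ s in (0 : ℝ)..t, f s) {t : ℝ} (ht : t ∈ Icc 0 T) :
    u t ^ 2 - u 0 ^ 2 = 2 * ∫ s in (0 : ℝ)..t, u s * f s := by
  have hsub : uIcc 0 t ⊆ uIcc 0 T := by
    rw [uIcc_of_le ht.1, uIcc_of_le (ht.1.trans ht.2)]
    exact Icc_subset_Icc_right ht.2
  have hft : IntervalIntegrable f volume 0 t := hf.mono_set hsub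
  -- The primitive stands in for `u`, which is known to agree with it only on `[0, T]`.
  have hac : AbsolutelyContinuousOnInterval (fun x => u 0 + ∫ s in (0 : ℝ)..x, f s) 0 t :=
    ((contDiff_const (c := u 0) (n := 1)).contDiffOn.absolutelyContinuousOnInterval).fun_add
      (hft.absolutelyContinuousOnInterval_intervalIntegral left_mem_uIcc)
  have h := hac.integral_deriv_mul_eq_sub hac
  have e : ∫ x in (0 : ℝ)..t, (deriv (fun x => u 0 + ∫ s in (0 : ℝ)..x, f s) x
        * (u 0 + ∫ s in (0 : ℝ)..x, f s)
        + (u 0 + ∫ s in (0 : ℝ)..x, f s) * deriv (fun x => u 0 + ∫ s in (0 : ℝ)..x, f s) x)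
      = ∫ s in (0 : ℝ)..t, 2 * (u s * f s) := by
    refine intervalIntegral.integral_congr_ae ?_
    filter_upwards [hft.ae_hasDerivAt_integral] with x hx hxt
    have hd := ((hx (uIoc_subset_uIcc hxt) 0 left_mem_uIcc).const_add (u 0)).deriv
    rw [uIoc_of_le ht.1] at hxt
    have hux := hu x ⟨hxt.1.le, hxt.2.trans ht.2⟩
    rw [hd, ← hux]
    ring
  rw [e, intervalIntegral.integral_const_mul] at h
  rw [h, ← hu t ht]
  simp only [intervalIntegral.integral_same]
  ring

theorem intervalIntegrable_mul_of_primitive {u f : ℝ → ℝ} {T : ℝ} (hT : 0 ≤ T)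
    (hf : IntervalIntegrable f volume 0 T)
    (hu : ∀ t ∈ Icc 0 T, u t - u 0 = ∫ s in (0 : ℝ)..t, f s) :
    IntervalIntegrable (fun s => u s * f s) volume 0 T := by
  refine hf.continuousOn_mul ?_
  have h1 : ContinuousOn (fun x => u 0 + ∫ s in (0 : ℝ)..x, f s) (uIcc 0 T) :=
    continuousOn_const.add (intervalIntegral.continuousOn_primitive_interval' hf left_mem_uIcc)
  refine h1.congr fun x hx => ?_
  rw [uIcc_of_le hT] at hx
  simp only [← hu x hx]
  ring

/-- Grönwall's inequality in integral form. -/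
theorem le_mul_exp_of_le_integral {y : ℝ → ℝ} {T c y₀ : ℝ} (hc : 0 ≤ c)
    (hy : ContinuousOn y (Icc 0 T))
    (h : ∀ t ∈ Icc 0 T, y t ≤ y₀ + c * ∫ s in (0 : ℝ)..t, y s) {t : ℝ} (ht : t ∈ Icc 0 T) :
    y t ≤ y₀ * Real.exp (c * t) := by
  have hT : 0 ≤ T := ht.1.trans ht.2
  have hint : IntervalIntegrable y volume 0 T := by
    apply ContinuousOn.intervalIntegrable
    rwa [uIcc_of_le hT]
  have hprim : ContinuousOn (fun x => ∫ s in (0 : ℝ)..x, y s) (Icc 0 T) := by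
    have := intervalIntegral.continuousOn_primitive_interval' hint left_mem_uIcc
    rwa [uIcc_of_le hT] at this
  have hd : ∀ x ∈ Ioo 0 T, HasDerivAt
      (fun x => Real.exp (-c * x) * (y₀ + c * ∫ s in (0 : ℝ)..x, y s))
      (Real.exp (-c * x) * (-c) * (y₀ + c * ∫ s in (0 : ℝ)..x, y s)
        + Real.exp (-c * x) * (c * y x)) x := by
    intro x hx
    have hxint : IntervalIntegrable y volume 0 x := hint.mono_set (by
      rw [uIcc_of_le hx.1.le, uIcc_of_le hT]
      exact Icc_subset_Icc_right hx.2.le)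
    have hyo : ContinuousOn y (Ioo 0 T) := hy.mono Ioo_subset_Icc_self
    have h1 := intervalIntegral.integral_hasDerivAt_right hxint
      (hyo.stronglyMeasurableAtFilter isOpen_Ioo x hx) (hyo.continuousAt (isOpen_Ioo.mem_nhds hx))
    have h2 : HasDerivAt (fun x => Real.exp (-c * x)) (Real.exp (-c * x) * (-c)) x := by
      simpa using ((hasDerivAt_id x).const_mul (-c)).exp
    exact h2.mul ((h1.const_mul c).const_add y₀)
  -- Integrating factor: the right-hand side of `h`, multiplied by `exp (-c x)`, is nonincreasing.
  have hanti : AntitoneOn (fun x => Real.exp (-c * x) * (y₀ + c * ∫ s in (0 : ℝ)..x, y s))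
      (Icc 0 T) := by
    refine antitoneOn_of_deriv_nonpos (convex_Icc 0 T) ?_ ?_ ?_
    · exact (by fun_prop : Continuous fun x => Real.exp (-c * x)).continuousOn.mul
        (continuousOn_const.add (continuousOn_const.mul hprim))
    · intro x hx
      rw [interior_Icc] at hx
      exact (hd x hx).differentiableAt.differentiableWithinAt
    · intro x hx
      rw [interior_Icc] at hx
      rw [(hd x hx).deriv]
      have h1 := mul_le_mul_of_nonneg_left (h x (Ioo_subset_Icc_self hx))
        (mul_nonneg (Real.exp_pos (-c * x)).le hc)
      nlinarith
  have h0 := hanti (left_mem_Icc.2 hT) ht ht.1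
  simp only [intervalIntegral.integral_same, mul_zero, add_zero, Real.exp_zero, one_mul] at h0
  refine (h t ht).trans ?_
  have e : Real.exp (-c * t) * Real.exp (c * t) = 1 := by
    rw [← Real.exp_add]; simp
  have h1 := mul_le_mul_of_nonneg_right h0 (Real.exp_pos (c * t)).le
  calc y₀ + c * ∫ s in (0 : ℝ)..t, y s
      = Real.exp (-c * t) * (y₀ + c * ∫ s in (0 : ℝ)..t, y s) * Real.exp (c * t) := by
        linear_combination (-(y₀ + c * ∫ s in (0 : ℝ)..t, y s)) * e
    _ ≤ _ := h1

/-! ### Reading off the hypotheses at almost every time -/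

theorem abs_le_of_ae_abs_le {f : ℝ → ℝ} (hf : Continuous f) {C : ℝ} (h : ∀ᵐ x, |f x| ≤ C) (x : ℝ) :
    |f x| ≤ C := by
  have hae : (fun x => max |f x| C) =ᵐ[volume] fun _ => C := by
    filter_upwards [h] with x hx
    exact max_eq_right hx
  have := congrFun ((Continuous.ae_eq_iff_eq volume (by fun_prop) continuous_const).1 hae) x
  exact max_eq_right_iff.1 this

/-- The derivatives up to order five are continuous, so their almost everywhere bounds hold at every
point. -/
theorem isProfile_of_memW6Star {m₁ m₂ L : ℝ} {φ : ℝ → ℝ} (hφ : MemW6Star L φ)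
    (h₁ : ∀ α, deriv φ α ≤ -m₁)
    (h₂ : ∀ i ∈ Finset.Icc 1 6, ∀ᵐ α, |iteratedDeriv i φ α| ≤ m₂) : IsProfile m₁ m₂ L φ := by
  have hb : ∀ i : ℕ, 1 ≤ i → i ≤ 5 → ∀ α, |iteratedDeriv i φ α| ≤ m₂ := by
    intro i hi hi5
    refine abs_le_of_ae_abs_le (hφ.2.1.continuous_iteratedDeriv i (by exact_mod_cast hi5))
      (h₂ i (Finset.mem_Icc.2 ⟨hi, by omega⟩))
  refine ⟨hφ.2.1.of_le (by norm_cast), fun α => ?_, h₁, fun α => ?_, fun α => ?_, fun α => ?_⟩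
  · linarith [hφ.1 α]
  · have := hb 1 le_rfl (by norm_num) α
    rw [iteratedDeriv_one] at this
    exact (abs_le.1 this).1
  · have := hb 2 (by norm_num) (by norm_num) α
    rwa [iteratedDeriv_two] at this
  · have := hb 3 (by norm_num) (by norm_num) α
    rwa [iteratedDeriv_succ, iteratedDeriv_two] at this

theorem cylinderMeasure_eq (T : ℝ) :
    cylinderMeasure T = (volume.restrict (Icc 0 T)).prod unitMeasure := by
  rw [cylinderMeasure, unitMeasure, Measure.prod_restrict, Measure.volume_eq_prod]

theorem intervalIntegrable_of_cylinder {T : ℝ} (hT : 0 ≤ T) {f : ℝ → ℝ → ℝ}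
    (hf : Integrable (fun p : ℝ × ℝ => f p.1 p.2) (cylinderMeasure T)) :
    IntervalIntegrable (fun s => ∫ x, f s x ∂unitMeasure) volume 0 T := by
  rw [cylinderMeasure_eq] at hf
  rw [intervalIntegrable_iff_integrableOn_Icc_of_le hT]
  exact hf.integral_prod_left

theorem eLpNorm_two_eq {f : ℝ → ℝ} (hf : MemLp f 2 unitMeasure) :
    eLpNorm f 2 unitMeasure = ENNReal.ofReal (Real.sqrt (∫ x, f x ^ 2 ∂unitMeasure)) := by
  rw [hf.eLpNorm_eq_integral_rpow_norm (by norm_num) (by norm_num), Real.sqrt_eq_rpow]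
  simp

/-- The energy identity for the linearized equation. -/
theorem energy_identity {m₁ m₂ L T : ℝ} (hm₁ : 0 < m₁) (hm₂ : 0 < m₂) (hT : 0 < T)
    {φ ψ : ℝ → ℝ → ℝ}
    (hφ : ∀ᵐ t ∂(volume.restrict (Icc (0 : ℝ) T)), IsProfile m₁ m₂ L (φ t))
    (hψ : IsLinearizedSolution L T φ ψ) :
    IntervalIntegrable (fun s => ∫ x, (fluxOne L (φ s) (ψ s) x * deriv (ψ s) x
      + fluxTwo L (φ s) (ψ s) x * deriv (deriv (ψ s)) x) ∂unitMeasure) volume 0 T ∧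
    ∀ t ∈ Icc 0 T, (∫ x, ψ t x ^ 2 ∂unitMeasure) - ∫ x, ψ 0 x ^ 2 ∂unitMeasure
      = 2 * ∫ s in (0 : ℝ)..t, ∫ x, (fluxOne L (φ s) (ψ s) x * deriv (ψ s) x
        + fluxTwo L (φ s) (ψ s) x * deriv (deriv (ψ s)) x) ∂unitMeasure := by
  obtain ⟨K, hK0, hK⟩ := exists_energy_bound m₁ m₂ hm₁ hm₂
  set G : ℝ → ℝ := fun s => ∫ x, (fluxOne L (φ s) (ψ s) x * deriv (ψ s) x
      + fluxTwo L (φ s) (ψ s) x * deriv (deriv (ψ s)) x) ∂unitMeasure with hG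
  set A : ℤ → ℝ → ℝ := fun k s => modePairing L (φ s) (ψ s) k with hA
  -- Each squared flux integrates to at most `K E`, and `ψ_α²` and `ψ_αα²` to at most `E`: in total
  -- `(2K + 2) E`.
  set bound : ℝ → ℝ := fun s => (2 * K + 2) * ∫ x, iteratedDeriv 2 (ψ s) x ^ 2 ∂unitMeasure
    with hbound
  have hbound_int : IntervalIntegrable bound volume 0 T :=
    (intervalIntegrable_of_cylinder hT.le (f := fun s x => iteratedDeriv 2 (ψ s) x ^ 2)
      (hψ.memL2H2 2 le_rfl).integrable_sq).const_mul _
  have hcos : ∀ k : ℤ, ∀ t ∈ Icc 0 T, cosCoeff (ψ t) k - cosCoeff (ψ 0) k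
      = ∫ s in (0 : ℝ)..t, ∫ x in (0 : ℝ)..1, weakIntegrand L (φ s) (ψ s) (cosWave k) x := by
    intro k t ht
    rw [← hψ.equation _ (contDiff_cosWave k) (periodic_cosWave k) t ht, intervalIntegral_eq_unit,
      intervalIntegral_eq_unit]
    rfl
  have hsin : ∀ k : ℤ, ∀ t ∈ Icc 0 T, sinCoeff (ψ t) k - sinCoeff (ψ 0) k
      = ∫ s in (0 : ℝ)..t, ∫ x in (0 : ℝ)..1, weakIntegrand L (φ s) (ψ s) (sinWave k) x := by
    intro k t ht
    rw [← hψ.equation _ (contDiff_sinWave k) (periodic_sinWave k) t ht, intervalIntegral_eq_unit,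
      intervalIntegral_eq_unit]
    rfl
  have icos : ∀ k : ℤ, IntervalIntegrable
      (fun s => ∫ x in (0 : ℝ)..1, weakIntegrand L (φ s) (ψ s) (cosWave k) x) volume 0 T := by
    intro k
    simp only [intervalIntegral_eq_unit]
    exact intervalIntegrable_of_cylinder hT.le
      (hψ.integrable _ (contDiff_cosWave k) (periodic_cosWave k))
  have isin : ∀ k : ℤ, IntervalIntegrable
      (fun s => ∫ x in (0 : ℝ)..1, weakIntegrand L (φ s) (ψ s) (sinWave k) x) volume 0 T := by
    intro k
    simp only [intervalIntegral_eq_unit]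
    exact intervalIntegrable_of_cylinder hT.le
      (hψ.integrable _ (contDiff_sinWave k) (periodic_sinWave k))
  have jcos := fun k => intervalIntegrable_mul_of_primitive hT.le (icos k) (hcos k)
  have jsin := fun k => intervalIntegrable_mul_of_primitive hT.le (isin k) (hsin k)
  have hAint : ∀ k, IntervalIntegrable (A k) volume 0 T := fun k => (jcos k).add (jsin k)
  have hmono : ∀ {t : ℝ}, t ∈ Icc 0 T → uIcc 0 t ⊆ uIcc 0 T := by
    intro t ht
    rw [uIcc_of_le ht.1, uIcc_of_le hT.le]
    exact Icc_subset_Icc_right ht.2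
  have hmode : ∀ k : ℤ, ∀ t ∈ Icc 0 T,
      (cosCoeff (ψ t) k ^ 2 + sinCoeff (ψ t) k ^ 2) - (cosCoeff (ψ 0) k ^ 2 + sinCoeff (ψ 0) k ^ 2)
        = 2 * ∫ s in (0 : ℝ)..t, A k s := by
    intro k t ht
    have h1 := sq_sub_sq_eq_integral (u := fun s => cosCoeff (ψ s) k) (icos k) (hcos k) ht
    have h2 := sq_sub_sq_eq_integral (u := fun s => sinCoeff (ψ s) k) (isin k) (hsin k) ht
    have h3 := intervalIntegral.integral_add ((jcos k).mono_set (hmono ht))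
      ((jsin k).mono_set (hmono ht))
    have h4 : ∫ s in (0 : ℝ)..t, A k s = _ := h3
    rw [h4]
    linarith
  have hae : ∀ᵐ s ∂(volume.restrict (Ioc 0 T)), (∀ F : Finset ℤ, ‖∑ k ∈ F, A k s‖ ≤ bound s) ∧
      Tendsto (fun F : Finset ℤ => ∑ k ∈ F, A k s) atTop (𝓝 (G s)) := by
    rw [Measure.restrict_congr_set Ioc_ae_eq_Icc]
    filter_upwards [hφ, hψ.memH2] with s hs hs2
    obtain ⟨m1, m2, b1, b2, b3, -⟩ := hK L (φ s) (ψ s) hs hs2 _ _ rfl rfl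
    refine ⟨fun F => ?_, hasSum_modePairing hm₁ hs hs2 m1 m2⟩
    refine (abs_sum_modePairing_le hm₁ hs hs2 m1 m2 F).trans ?_
    simp only [hbound, iteratedDeriv_two]
    linarith
  have hSint : ∀ F : Finset ℤ, IntervalIntegrable (fun s => ∑ k ∈ F, A k s) volume 0 T := by
    intro F
    simpa only [Finset.sum_fn] using IntervalIntegrable.sum F fun k _ => hAint k
  -- Measurability of `G` in time is inherited from the partial sums of modes, which converge to it
  -- almost everywhere.
  have hGint : IntervalIntegrable G volume 0 T := by
    have hm : AEStronglyMeasurable G (volume.restrict (Ioc 0 T)) := by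
      refine aestronglyMeasurable_of_tendsto_ae (atTop : Filter (Finset ℤ))
        (f := fun F s => ∑ k ∈ F, A k s) (fun F => ?_) (hae.mono fun s hs => hs.2)
      exact ((intervalIntegrable_iff_integrableOn_Ioc_of_le hT.le).1
        (hSint F)).aestronglyMeasurable
    rw [intervalIntegrable_iff_integrableOn_Ioc_of_le hT.le] at hbound_int ⊢
    refine Integrable.mono' hbound_int hm (hae.mono fun s hs => ?_)
    exact le_of_tendsto' hs.2.norm hs.1
  refine ⟨hGint, fun t ht => ?_⟩
  have hlim1 : Tendsto (fun F : Finset ℤ => ∑ k ∈ F, ((cosCoeff (ψ t) k ^ 2 + sinCoeff (ψ t) k ^ 2)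
      - (cosCoeff (ψ 0) k ^ 2 + sinCoeff (ψ 0) k ^ 2))) atTop
      (𝓝 ((∫ x, ψ t x ^ 2 ∂unitMeasure) - ∫ x, ψ 0 x ^ 2 ∂unitMeasure)) :=
    (hasSum_sq_coeff (hψ.memL2 t ht)).sub (hasSum_sq_coeff (hψ.memL2 0 (left_mem_Icc.2 hT.le)))
  have hlim2 : Tendsto (fun F : Finset ℤ => ∫ s in (0 : ℝ)..t, ∑ k ∈ F, A k s) atTop
      (𝓝 (∫ s in (0 : ℝ)..t, G s)) := by
    have hae' := (ae_restrict_iff' measurableSet_Ioc).1 hae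
    have hIoc : Ioc 0 t ⊆ Ioc 0 T := Ioc_subset_Ioc_right ht.2
    refine intervalIntegral.tendsto_integral_filter_of_dominated_convergence bound
      (Eventually.of_forall fun F => ?_) (Eventually.of_forall fun F => ?_)
      (hbound_int.mono_set (hmono ht)) ?_
    · exact ((hSint F).mono_set (hmono ht)).aestronglyMeasurable_restrict_uIoc
    · filter_upwards [hae'] with s hs hst
      rw [uIoc_of_le ht.1] at hst
      exact (hs (hIoc hst)).1 F
    · filter_upwards [hae'] with s hs hst
      rw [uIoc_of_le ht.1] at hst
      exact (hs (hIoc hst)).2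
  refine tendsto_nhds_unique hlim1 ((hlim2.const_mul 2).congr fun F => ?_)
  rw [intervalIntegral.integral_finsetSum fun k _ => (hAint k).mono_set (hmono ht),
    Finset.mul_sum]
  exact Finset.sum_congr rfl fun k _ => (hmode k t ht).symm

end StepFlow

/-! ### Conclusion by Grönwall -/

open StepFlow in
theorem mainTheorem8 (m₁ m₂ T : ℝ) (hm₁ : 0 < m₁) (hm₂ : 0 < m₂) (hT : 0 < T) :
    ∃ C : ℝ, 0 < C ∧
      ∀ (L : ℝ) (φ ψ : ℝ → ℝ → ℝ), 0 < L →
        StepFlow.IsStrongSolution L T φ →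
        StepFlow.HasBounds m₁ m₂ T φ →
        StepFlow.IsLinearizedSolution L T φ ψ →
        ∀ t ∈ Set.Icc (0 : ℝ) T,
          MeasureTheory.eLpNorm (ψ t) 2 StepFlow.unitMeasure ≤
            ENNReal.ofReal C * MeasureTheory.eLpNorm (ψ 0) 2 StepFlow.unitMeasure := by
  obtain ⟨K, hK0, hK⟩ := exists_energy_bound m₁ m₂ hm₁ hm₂
  -- Grönwall gives the factor `exp (2 K t)` for the squared norm; its square root is at most `exp
  -- (K T)`.
  refine ⟨Real.exp (K * T), Real.exp_pos _, fun L φ ψ _ hφ hb hψ t ht => ?_⟩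
  have hprof : ∀ᵐ t ∂(volume.restrict (Icc (0 : ℝ) T)), IsProfile m₁ m₂ L (φ t) := by
    filter_upwards [hφ.regular, hb] with s hs hs2
    exact isProfile_of_memW6Star hs hs2.1 hs2.2
  obtain ⟨hGint, hid⟩ := energy_identity hm₁ hm₂ hT hprof hψ
  set G : ℝ → ℝ := fun s => ∫ x, (fluxOne L (φ s) (ψ s) x * deriv (ψ s) x
      + fluxTwo L (φ s) (ψ s) x * deriv (deriv (ψ s)) x) ∂unitMeasure
  set N : ℝ → ℝ := fun s => ∫ x, ψ s x ^ 2 ∂unitMeasure with hN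
  have hNeq : ∀ t ∈ Icc 0 T, N t = N 0 + 2 * ∫ s in (0 : ℝ)..t, G s := fun t ht => by
    have : N t - N 0 = _ := hid t ht
    linarith
  have hNcont : ContinuousOn N (Icc 0 T) := by
    have h1 : ContinuousOn (fun x => N 0 + 2 * ∫ s in (0 : ℝ)..x, G s) (uIcc 0 T) :=
      continuousOn_const.add (continuousOn_const.mul
        (intervalIntegral.continuousOn_primitive_interval' hGint left_mem_uIcc))
    rw [uIcc_of_le hT.le] at h1
    exact h1.congr hNeq
  have hgron : ∀ t ∈ Icc 0 T, N t ≤ N 0 + 2 * K * ∫ s in (0 : ℝ)..t, N s := by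
    intro t ht
    have hsub : uIcc 0 t ⊆ uIcc 0 T := by
      rw [uIcc_of_le ht.1, uIcc_of_le hT.le]
      exact Icc_subset_Icc_right ht.2
    have hNint : IntervalIntegrable N volume 0 t := by
      apply ContinuousOn.intervalIntegrable
      rw [uIcc_of_le ht.1]
      exact hNcont.mono (Icc_subset_Icc_right ht.2)
    have hle : ∫ s in (0 : ℝ)..t, G s ≤ ∫ s in (0 : ℝ)..t, K * N s := by
      refine intervalIntegral.integral_mono_ae_restrict ht.1 (hGint.mono_set hsub)
        (hNint.const_mul K) ?_
      have hae : ∀ᵐ s ∂(volume.restrict (Icc 0 T)), G s ≤ K * N s := by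
        filter_upwards [hprof, hψ.memH2] with s hs hs2
        exact (hK L (φ s) (ψ s) hs hs2 _ _ rfl rfl).2.2.2.2.2
      exact ae_restrict_of_ae_restrict_of_subset (Icc_subset_Icc_right ht.2) hae
    rw [intervalIntegral.integral_const_mul] at hle
    rw [hNeq t ht]
    linarith
  have hfinal := le_mul_exp_of_le_integral (by positivity) hNcont hgron ht
  have hN0 : 0 ≤ N 0 := integral_nonneg fun _ => sq_nonneg _
  rw [eLpNorm_two_eq (hψ.memL2 t ht), eLpNorm_two_eq (hψ.memL2 0 (left_mem_Icc.2 hT.le)),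
    ← ENNReal.ofReal_mul (Real.exp_pos _).le]
  refine ENNReal.ofReal_le_ofReal (Real.sqrt_le_iff.2 ⟨by positivity, ?_⟩)
  rw [mul_pow, Real.sq_sqrt hN0, ← Real.exp_nat_mul]
  refine hfinal.trans ?_
  rw [mul_comm]
  gcongr ?_ * _
  refine Real.exp_le_exp.2 ?_
  have := mul_le_mul_of_nonneg_left ht.2 hK0
  push_cast
  linarith
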